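/- For functions on $\mathbb{R}$ let $\hat f(k)=\frac{1}{\sqrt{2\pi}}\int_{\mathbb{R}}f(x)e^{-ikx}\,dx$, and define the Hilbert transform $\mathcal{H}$ and the operator $\Lambda$ (with its powers) by $\widehat{\mathcal{H}f}(k)=-i\,\mathrm{sgn}(k)\hat f(k)$ and $\widehat{\Lambda^n f}(k)=|k|^n\hat f(k)$. Write $[\mathcal{H},f]g=\mathcal{H}(fg)-f\,\mathcal{H}g$. Theorem 3. Let $\varepsilon>0$, $\alpha_o>0$ and $\beta\ge 0$ be constants, and let $f_0\in H^3(\mathbb{R})$ be real-valued. Then there are $T^*>0$ and a unique real-valued solution $f\in L^\infty(0,T^*;H^3(\mathbb{R}))$ of $$2f_t+\alpha_o\Lambda f_t=\frac1\varepsilon\left\{f_x+\mathcal{H}f+(\alpha_o-\beta)\mathcal{H}f_{xx}\right\}+\mathcal{H}\left((\Lambda f)^2\right)-[\mathcal{H},f]\Lambda f+(\alpha_o-\beta)[\mathcal{H},f]\Lambda^3 f,\qquad f(\cdot,0)=f_0 .$$ Here $f\in L^\infty(0,T;H^3(\mathbb{R}))$ is called a solution on $(0,T)$ if there is $f_t\in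 L^1(0,T;L^2(\mathbb{R}))$ with $f(t)=f_0+\int_0^t f_t(s)\,ds$ for almost every $t\in(0,T)$ and if, for almost every $t\in(0,T)$, $f_t(t)\in H^1(\mathbb{R})$ and the equation holds in $L^2(\mathbb{R})$. Uniqueness means: if $0<T\le T^*$ and $g\in L^\infty(0,T;H^3(\mathbb{R}))$ is a solution on $(0,T)$ with the same initial datum, then $g(t)=f(t)$ for almost every $t\in(0,T)$. -/

import Mathlib

open MeasureTheory FourierTransform
open scoped ENNReal SchwartzMap

namespace OddWaves

noncomputable section

/-- Real-valued `L²(ℝ)`. -/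
abbrev L2R : Type := Lp ℝ 2 (volume : Measure ℝ)

/-- Complex-valued `L²(ℝ)`. -/
abbrev L2C : Type := Lp ℂ 2 (volume : Measure ℝ)

/-- A real-valued `L²` function regarded as a complex-valued one. -/
def toC (f : L2R) : L2C := Complex.ofRealCLM.compLp f

open Classical in
/-- The Fourier multiplier operator with symbol `m`, i.e. `f ↦ m(D) f` where
`(m(D) f)^(k) = m(k) f^(k)` and `f^(k) = (2π)^(-1/2) ∫ f(x) exp(-ikx) dx`. Mathlib's transform
is `𝓕 f ξ = ∫ f(x) exp(-2πixξ) dx`, so that the frequency is `k = 2πξ`. The domain consists of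
the `f ∈ L²` with `m f^ ∈ L²`; outside the domain the value is `0`. -/
def multiplier (m : ℝ → ℂ) (f : L2C) : L2C :=
  if h : MemLp (fun ξ : ℝ => m (2 * Real.pi * ξ) * (𝓕 f : L2C) ξ) 2 volume
  then 𝓕⁻ h.toLp else 0

/-- The Hilbert transform, with symbol `-i sgn k`. -/
def hilbert : L2C → L2C := multiplier fun k => -Complex.I * (Real.sign k : ℂ)

/-- `Λⁿ`, with symbol `|k|ⁿ`; its domain is `Hⁿ(ℝ)`. -/
def lambdaPow (n : ℕ) : L2C → L2C := multiplier fun k => ((|k| ^ n : ℝ) : ℂ)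

/-- The `n`-th (weak) derivative on `Hⁿ(ℝ)`, with symbol `(ik)ⁿ`. -/
def dx (n : ℕ) : L2C → L2C := multiplier fun k => (Complex.I * (k : ℂ)) ^ n

open Classical in
/-- The pointwise product of two `L²` functions whose product is in `L²` (`0` otherwise). -/
def mul (f g : L2C) : L2C :=
  if h : MemLp (fun x : ℝ => f x * g x) 2 volume then h.toLp else 0

/-- The commutator `[𝒯, f] g = 𝒯 (f g) - f 𝒯 g`. -/
def comm (T : L2C → L2C) (f g : L2C) : L2C := T (mul f g) - mul f (T g)

/-- `f ∈ Hˢ(ℝ)` for a real-valued `f ∈ L²(ℝ)`. -/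
def MemH (s : ℝ) (f : L2R) : Prop :=
  TemperedDistribution.MemSobolev s 2 (toC f : 𝓢'(ℝ, ℂ))

/-- The measure on the time interval `(0, T)`. -/
abbrev timeMeasure (T : ℝ) : Measure ℝ := volume.restrict (Set.Ioo 0 T)

/-- `f ∈ L^∞(0, T; Hˢ(ℝ))`: the Bessel potential operator `Jˢ`, an isometry of `Hˢ` onto `L²`,
takes `f` to an element of `L^∞(0, T; L²)`. -/
def MemLinftyH (s T : ℝ) (f : ℝ → L2R) : Prop :=
  ∃ g : ℝ → L2C, MemLp g ∞ (timeMeasure T) ∧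
    ∀ᵐ t ∂timeMeasure T,
      TemperedDistribution.besselPotential ℝ ℂ s (toC (f t) : 𝓢'(ℝ, ℂ)) = (g t : 𝓢'(ℝ, ℂ))

/-- The right-hand side
`ε⁻¹ {f_x + H f + (α - β) H f_xx} + H ((Λ f)²) - [H, f] Λ f + (α - β) [H, f] Λ³ f`. -/
def rhs (α β ε : ℝ) (f : L2C) : L2C :=
  ε⁻¹ • (dx 1 f + hilbert f + (α - β) • hilbert (dx 2 f))
    + hilbert (mul (lambdaPow 1 f) (lambdaPow 1 f))
    - comm hilbert f (lambdaPow 1 f)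
    + (α - β) • comm hilbert f (lambdaPow 3 f)

/-- `f ∈ L^∞(0, T; H³(ℝ))` is a (strong) solution on `(0, T)` of
`2 f_t + α Λ f_t = rhs f`, `f(0) = f₀`: the map `f` is absolutely continuous in time with values
in `L²(ℝ)` (up to a null set of times), with initial value `f₀` and time derivative `f_t`, and
for almost every time `f_t` is in the domain `H¹(ℝ)` of `Λ` and the equation holds in `L²(ℝ)`. -/
def IsSolution (α β ε T : ℝ) (f₀ : L2R) (f : ℝ → L2R) : Prop :=
  MemLinftyH 3 T f ∧
  ∃ ft : ℝ → L2R, Integrable ft (timeMeasure T) ∧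
    (∀ᵐ t ∂timeMeasure T, f t = f₀ + ∫ s in (0 : ℝ)..t, ft s) ∧
    ∀ᵐ t ∂timeMeasure T, MemH 1 (ft t) ∧
      (2 : ℝ) • toC (ft t) + α • lambdaPow 1 (toC (ft t)) = rhs α β ε (toC (f t))

end

end OddWaves

namespace OddWaves

open Filter Topology

noncomputable section

/-! Write the Fourier transform of `f` as `⟨ξ⟩⁻³ Φ`, so that `f ∈ H³` means `Φ ∈ L²`. Dividing the
equation by the symbol `2 + α|k|` turns it into `∂ₜ Φ = i p Φ + B(Φ, Φ)`, where `p` is a real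
dispersion symbol and `B` is a weighted convolution. The symbol `p` has order one: its numerator has
order two and the division gains one order (`abs_dispersion_le`).

The heart of the matter is that `B` is bounded on `L²` (`norm_quadKernel_le`). After the division,
two powers of the output frequency `k` remain from the weight. In the commutator terms the factor
`sgn k - sgn l` vanishes unless `|k| ≤ |k - l|`, so both powers can be charged to the
undifferentiated factor, while the three derivatives on the other factor use up exactly its own `H³`
weight. In `H((Λf)²)` each factor carries one derivative and the two powers go to either factor. A
spare `⟨·⟩⁻¹` is always left over; it is square integrable on the line, and Cauchy–Schwarz finishes
the bound (`isKernel_of_le`).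

Since `p` is real, `exp(itp)` is unitary, and `U = exp(-itp) Φ` solves an ordinary differential
equation in `L²` whose field is locally Lipschitz uniformly in time. Picard–Lindelöf gives a local
solution. A product rule under weights that tame `p` (`apply_integral_eq`) carries solutions back to
the original equation, and carries any solution of the stated class to the integral equation for `U`
at almost every time. Uniqueness for the differential equation then gives uniqueness of `f`.

Real-valuedness corresponds to invariance under `Φ ↦ conj Φ(-ξ)`. The field commutes with this
involution, so uniqueness preserves the symmetry of the datum (`IsReal.reflConj_eq`). -/

/-- The squared norm in `L²` as an integral. -/
theorem enorm_sq_eq_lintegral (f : L2C) : ‖f‖ₑ ^ 2 = ∫⁻ x, ‖f x‖ₑ ^ 2 := by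
  have h := eLpNorm_nnreal_pow_eq_lintegral (f := f) (μ := (volume : Measure ℝ)) (p := 2)
    (by norm_num)
  rw [Lp.enorm_def]
  simpa using h

/-! ### Multiplication operators with bounded symbols. -/

/-- Bounded measurable symbols. -/
def IsBddSymbol (m : ℝ → ℂ) : Prop := Measurable m ∧ ∃ C : ℝ, ∀ ξ, ‖m ξ‖ ≤ C

theorem IsBddSymbol.memLp {m : ℝ → ℂ} (h : IsBddSymbol m) : MemLp m ∞ volume :=
  let ⟨C, hC⟩ := h.2
  memLp_top_of_bound h.1.aestronglyMeasurable C (Eventually.of_forall hC)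

theorem IsBddSymbol.mul {m n : ℝ → ℂ} (hm : IsBddSymbol m) (hn : IsBddSymbol n) :
    IsBddSymbol (fun ξ => m ξ * n ξ) := by
  obtain ⟨hm, C, hC⟩ := hm
  obtain ⟨hn, D, hD⟩ := hn
  refine ⟨hm.mul hn, C * D, fun ξ => ?_⟩
  rw [norm_mul]
  exact mul_le_mul (hC ξ) (hD ξ) (norm_nonneg _) ((norm_nonneg _).trans (hC ξ))

open Classical in
/-- Multiplication by a bounded function, as a bounded operator on `L²`. -/
def mulOp (m : ℝ → ℂ) : L2C →L[ℂ] L2C :=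
  if h : MemLp m ∞ volume then
    (ContinuousLinearMap.mul ℂ ℂ).holderL (volume : Measure ℝ) ∞ 2 2 h.toLp
  else 0

theorem coeFn_mulOp {m : ℝ → ℂ} (h : IsBddSymbol m) (f : L2C) :
    mulOp m f =ᵐ[volume] fun ξ => m ξ * f ξ := by
  rw [mulOp, dif_pos h.memLp]
  have h1 := ContinuousLinearMap.coeFn_holder (r := 2) (ContinuousLinearMap.mul ℂ ℂ)
    (h.memLp.toLp) f
  filter_upwards [h1, h.memLp.coeFn_toLp] with ξ h2 h3
  rw [← h3]
  exact h2

theorem mulOp_mulOp {m n : ℝ → ℂ} (hm : IsBddSymbol m) (hn : IsBddSymbol n) (f : L2C) :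
    mulOp m (mulOp n f) = mulOp (fun ξ => m ξ * n ξ) f := by
  apply Lp.ext
  filter_upwards [coeFn_mulOp hm (mulOp n f), coeFn_mulOp hn f, coeFn_mulOp (hm.mul hn) f]
    with ξ h1 h2 h3
  rw [h1, h2, h3, mul_assoc]

theorem mulOp_one (f : L2C) : mulOp (fun _ => 1) f = f := by
  apply Lp.ext
  filter_upwards [coeFn_mulOp (m := fun _ => 1) ⟨measurable_const, 1, by simp⟩ f] with ξ h
  simpa using h

theorem eq_mulOp_of_ae_eq {m : ℝ → ℂ} (hm : IsBddSymbol m) {f g : L2C}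
    (h : g =ᵐ[volume] fun ξ => m ξ * f ξ) : g = mulOp m f :=
  Lp.ext (h.trans (coeFn_mulOp hm f).symm)

theorem norm_mulOp_apply_le {m : ℝ → ℂ} (hm : Measurable m) {C : ℝ} (hC : ∀ ξ, ‖m ξ‖ ≤ C)
    (f : L2C) : ‖mulOp m f‖ ≤ C * ‖f‖ := by
  apply Lp.norm_le_mul_norm_of_ae_le_mul
  filter_upwards [coeFn_mulOp ⟨hm, C, hC⟩ f] with ξ h
  rw [h, norm_mul]
  exact mul_le_mul_of_nonneg_right (hC ξ) (norm_nonneg _)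

theorem norm_mulOp_apply_eq {m : ℝ → ℂ} (hm : Measurable m) (hC : ∀ ξ, ‖m ξ‖ = 1)
    (f : L2C) : ‖mulOp m f‖ = ‖f‖ := by
  rw [Lp.norm_def, Lp.norm_def]
  congr 1
  apply eLpNorm_congr_norm_ae
  filter_upwards [coeFn_mulOp ⟨hm, 1, fun ξ => (hC ξ).le⟩ f] with ξ h
  rw [h, norm_mul, hC, one_mul]

theorem mulOp_injective {m : ℝ → ℂ} (hm : IsBddSymbol m) (h0 : ∀ ξ, m ξ ≠ 0) :
    Function.Injective (mulOp m) := by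
  intro f g h
  apply Lp.ext
  have h' : mulOp m f =ᵐ[volume] mulOp m g := by rw [h]
  filter_upwards [coeFn_mulOp hm f, coeFn_mulOp hm g, h'] with ξ h1 h2 h3
  rw [h1, h2] at h3
  exact mul_left_cancel₀ (h0 ξ) h3

/-- Dominated convergence for multiplication operators. -/
theorem tendsto_mulOp {ι : Type*} {l : Filter ι} [l.IsCountablyGenerated] {m : ι → ℝ → ℂ}
    {m₀ : ℝ → ℂ} {C : ℝ} (hm : ∀ i, Measurable (m i)) (hm₀ : Measurable m₀)
    (hC : ∀ i ξ, ‖m i ξ‖ ≤ C) (hC₀ : ∀ ξ, ‖m₀ ξ‖ ≤ C)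
    (h : ∀ ξ, Tendsto (fun i => m i ξ) l (𝓝 (m₀ ξ))) (f : L2C) :
    Tendsto (fun i => mulOp (m i) f) l (𝓝 (mulOp m₀ f)) := by
  rw [tendsto_iff_edist_tendsto_0]
  have key : Tendsto (fun i => ∫⁻ ξ, ‖(m i ξ - m₀ ξ) * f ξ‖ₑ ^ 2) l (𝓝 (∫⁻ _ : ℝ, 0)) := by
    refine tendsto_lintegral_filter_of_dominated_convergence
      (fun ξ => ENNReal.ofReal (2 * C) ^ 2 * ‖f ξ‖ₑ ^ 2) ?_ ?_ ?_ ?_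
    · refine Eventually.of_forall fun i => ?_
      have := (Lp.aestronglyMeasurable f).aemeasurable
      have h1 := (hm i).aemeasurable (μ := volume)
      have h2 := hm₀.aemeasurable (μ := volume)
      fun_prop
    · refine Eventually.of_forall fun i => Eventually.of_forall fun ξ => ?_
      rw [enorm_mul, mul_pow]
      gcongr
      rw [← ofReal_norm]
      apply ENNReal.ofReal_le_ofReal
      linarith [norm_sub_le (m i ξ) (m₀ ξ), hC i ξ, hC₀ ξ]
    · rw [lintegral_const_mul' _ _ (by finiteness), ← enorm_sq_eq_lintegral]
      finiteness
    · refine Eventually.of_forall fun ξ => ?_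
      have h1 : Tendsto (fun i => (m i ξ - m₀ ξ) * f ξ) l (𝓝 0) := by
        simpa using ((h ξ).sub_const (m₀ ξ)).mul_const (f ξ)
      have h2 := (ENNReal.continuous_pow 2).tendsto _ |>.comp h1.enorm
      simpa [Function.comp_def] using h2
  rw [lintegral_zero] at key
  have h3 : (fun i => edist (mulOp (m i) f) (mulOp m₀ f)) =
      fun i => (∫⁻ ξ, ‖(m i ξ - m₀ ξ) * f ξ‖ₑ ^ 2) ^ (2⁻¹ : ℝ) := by
    funext i
    have h4 : ∫⁻ ξ, ‖(m i ξ - m₀ ξ) * f ξ‖ₑ ^ 2 = ‖mulOp (m i) f - mulOp m₀ f‖ₑ ^ 2 := by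
      rw [enorm_sq_eq_lintegral]
      apply lintegral_congr_ae
      filter_upwards [coeFn_mulOp ⟨hm i, C, hC i⟩ f, coeFn_mulOp ⟨hm₀, C, hC₀⟩ f,
        Lp.coeFn_sub (mulOp (m i) f) (mulOp m₀ f)] with ξ e1 e2 e3
      rw [e3, Pi.sub_apply, e1, e2, sub_mul]
    rw [h4, edist_eq_enorm_sub, ← ENNReal.rpow_natCast, ← ENNReal.rpow_mul]
    norm_num
  rw [h3]
  have h5 := (ENNReal.continuous_rpow_const (y := (2⁻¹ : ℝ))).tendsto 0 |>.comp key
  simpa [Function.comp_def] using h5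

/-! ### Bilinear operators with kernels square integrable in the inner variable. -/

/-- The Cauchy–Schwarz inequality for lower Lebesgue integrals. -/
theorem sq_lintegral_mul_le {f g : ℝ → ℝ≥0∞} (hf : AEMeasurable f) (hg : AEMeasurable g) :
    (∫⁻ x, f x * g x) ^ 2 ≤ (∫⁻ x, f x ^ 2) * ∫⁻ x, g x ^ 2 := by
  have h := ENNReal.lintegral_mul_le_Lp_mul_Lq (volume : Measure ℝ)
    (Real.HolderConjugate.two_two) hf hg
  calc (∫⁻ x, f x * g x) ^ 2
      ≤ ((∫⁻ x, f x ^ (2 : ℝ)) ^ (1 / 2 : ℝ) * (∫⁻ x, g x ^ (2 : ℝ)) ^ (1 / 2 : ℝ)) ^ 2 := by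
        gcongr
        exact h
    _ = _ := by
        rw [mul_pow, ← ENNReal.rpow_natCast, ← ENNReal.rpow_natCast, ← ENNReal.rpow_mul,
          ← ENNReal.rpow_mul]
        norm_num

/-- Kernels `b` for which `(Φ, Ψ) ↦ ∫ b(ξ, η) Φ(ξ - η) Ψ(η) dη` is bounded on `L²`. -/
def IsKernel (b : ℝ → ℝ → ℂ) (M : ℝ) : Prop :=
  Measurable (Function.uncurry b) ∧ 0 ≤ M ∧ ∀ ξ, ∫⁻ η, ‖b ξ η‖ₑ ^ 2 ≤ ENNReal.ofReal M ^ 2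

/-- The function `ξ ↦ ∫ b(ξ, η) Φ(ξ - η) Ψ(η) dη`. -/
def kernelFun (b : ℝ → ℝ → ℂ) (Φ Ψ : ℝ → ℂ) (ξ : ℝ) : ℂ :=
  ∫ η, b ξ η * (Φ (ξ - η) * Ψ η)

theorem measurable_coeFn (Φ : L2C) : Measurable Φ := (Lp.stronglyMeasurable Φ).measurable

theorem ae_sub_left {p : ℝ → Prop} (h : ∀ᵐ x, p x) (ξ : ℝ) : ∀ᵐ η, p (ξ - η) :=
  (quasiMeasurePreserving_sub_left (volume : Measure ℝ) ξ).ae h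

theorem kernelFun_congr {b : ℝ → ℝ → ℂ} {Φ Φ' Ψ Ψ' : ℝ → ℂ} (h : Φ =ᵐ[volume] Φ')
    (h' : Ψ =ᵐ[volume] Ψ') : kernelFun b Φ Ψ = kernelFun b Φ' Ψ' := by
  funext ξ
  apply integral_congr_ae
  filter_upwards [ae_sub_left h ξ, h'] with η h1 h2
  rw [h1, h2]

/-- Cauchy–Schwarz in `η` splits off the kernel, whose `L²` norm is at most `M` for every `ξ`. What
remains is the convolution of `|Φ|²` and `|Ψ|²`, integrated by Tonelli and translation invariance.
The absolute values stay inside so that integrability follows as well as the norm bound. -/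
theorem lintegral_sq_lintegral_kernel_le {b : ℝ → ℝ → ℂ} {M : ℝ} (hb : IsKernel b M)
    (Φ Ψ : L2C) :
    ∫⁻ ξ, (∫⁻ η, ‖b ξ η * (Φ (ξ - η) * Ψ η)‖ₑ) ^ 2 ≤
      ENNReal.ofReal M ^ 2 * (‖Φ‖ₑ ^ 2 * ‖Ψ‖ₑ ^ 2) := by
  have hΦ := measurable_coeFn Φ
  have hΨ := measurable_coeFn Ψ
  have hbm := hb.1
  calc ∫⁻ ξ, (∫⁻ η, ‖b ξ η * (Φ (ξ - η) * Ψ η)‖ₑ) ^ 2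
      ≤ ∫⁻ ξ, ENNReal.ofReal M ^ 2 * ∫⁻ η, ‖Φ (ξ - η)‖ₑ ^ 2 * ‖Ψ η‖ₑ ^ 2 := by
        refine lintegral_mono fun ξ => ?_
        have hbξ : Measurable (b ξ) := hbm.comp measurable_prodMk_left
        have h1 : ∫⁻ η, ‖b ξ η * (Φ (ξ - η) * Ψ η)‖ₑ =
            ∫⁻ η, ‖b ξ η‖ₑ * (‖Φ (ξ - η)‖ₑ * ‖Ψ η‖ₑ) := by simp only [enorm_mul]
        have h2 := sq_lintegral_mul_le (f := fun η => ‖b ξ η‖ₑ)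
          (g := fun η => ‖Φ (ξ - η)‖ₑ * ‖Ψ η‖ₑ) (by fun_prop) (by fun_prop)
        rw [h1]
        refine h2.trans ?_
        simp only [mul_pow]
        gcongr
        exact hb.2.2 ξ
    _ = ENNReal.ofReal M ^ 2 * ∫⁻ ξ, ∫⁻ η, ‖Φ (ξ - η)‖ₑ ^ 2 * ‖Ψ η‖ₑ ^ 2 := by
        rw [lintegral_const_mul' _ _ (by finiteness)]
    _ = ENNReal.ofReal M ^ 2 * (‖Φ‖ₑ ^ 2 * ‖Ψ‖ₑ ^ 2) := by
        congr 1
        rw [lintegral_lintegral_swap (by fun_prop)]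
        have h3 : ∀ η, ∫⁻ ξ, ‖Φ (ξ - η)‖ₑ ^ 2 * ‖Ψ η‖ₑ ^ 2 = ‖Φ‖ₑ ^ 2 * ‖Ψ η‖ₑ ^ 2 := by
          intro η
          rw [lintegral_mul_const' _ _ (by finiteness),
            lintegral_sub_right_eq_self (fun x => ‖Φ x‖ₑ ^ 2) η, ← enorm_sq_eq_lintegral]
        simp only [h3]
        rw [lintegral_const_mul' _ _ (by finiteness), ← enorm_sq_eq_lintegral]

/-- A function with finite integral is finite almost everywhere. This is what makes the Bochner
integral in `kernelFun` additive in each argument. -/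
theorem ae_integrable_kernel {b : ℝ → ℝ → ℂ} {M : ℝ} (hb : IsKernel b M) (Φ Ψ : L2C) :
    ∀ᵐ ξ, Integrable (fun η => b ξ η * (Φ (ξ - η) * Ψ η)) := by
  have hΦ := measurable_coeFn Φ
  have hΨ := measurable_coeFn Ψ
  have hbm := hb.1
  have h := lintegral_sq_lintegral_kernel_le hb Φ Ψ
  have h1 : ∀ᵐ ξ, (∫⁻ η, ‖b ξ η * (Φ (ξ - η) * Ψ η)‖ₑ) ^ 2 < ∞ := by
    refine ae_lt_top' ?_ (ne_of_lt (h.trans_lt (by finiteness)))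
    have : Measurable (Function.uncurry fun ξ η => ‖b ξ η * (Φ (ξ - η) * Ψ η)‖ₑ) := by
      have h2 : Measurable fun q : ℝ × ℝ => b q.1 q.2 := hbm
      simp only [Function.uncurry_def]
      fun_prop
    exact (this.lintegral_prod_right.pow_const 2).aemeasurable
  filter_upwards [h1] with ξ hξ
  have hbξ : Measurable (b ξ) := hbm.comp measurable_prodMk_left
  refine ⟨by fun_prop, ?_⟩
  rw [hasFiniteIntegral_iff_enorm]
  by_contra hcon
  rw [not_lt, top_le_iff] at hcon
  rw [hcon] at hξ
  simp at hξ

theorem aestronglyMeasurable_kernelFun {b : ℝ → ℝ → ℂ} {M : ℝ} (hb : IsKernel b M) (Φ Ψ : L2C) :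
    AEStronglyMeasurable (kernelFun b Φ Ψ) := by
  have hΦ := measurable_coeFn Φ
  have hΨ := measurable_coeFn Ψ
  have : Measurable (Function.uncurry fun ξ η => b ξ η * (Φ (ξ - η) * Ψ η)) := by
    have h2 : Measurable fun q : ℝ × ℝ => b q.1 q.2 := hb.1
    simp only [Function.uncurry_def]
    fun_prop
  exact this.stronglyMeasurable.integral_prod_right.aestronglyMeasurable

theorem lintegral_kernelFun_le {b : ℝ → ℝ → ℂ} {M : ℝ} (hb : IsKernel b M) (Φ Ψ : L2C) :
    ∫⁻ ξ, ‖kernelFun b Φ Ψ ξ‖ₑ ^ 2 ≤ ENNReal.ofReal M ^ 2 * (‖Φ‖ₑ ^ 2 * ‖Ψ‖ₑ ^ 2) := by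
  refine le_trans (lintegral_mono fun ξ => ?_) (lintegral_sq_lintegral_kernel_le hb Φ Ψ)
  gcongr
  exact enorm_integral_le_lintegral_enorm _

theorem memLp_two_of_lintegral_sq {f : ℝ → ℂ} (hf : AEStronglyMeasurable f)
    (h : ∫⁻ ξ, ‖f ξ‖ₑ ^ 2 < ∞) : MemLp f 2 volume := by
  refine ⟨hf, ?_⟩
  rw [eLpNorm_lt_top_iff_lintegral_rpow_enorm_lt_top (by norm_num) (by norm_num)]
  simpa using h

theorem memLp_kernelFun {b : ℝ → ℝ → ℂ} {M : ℝ} (hb : IsKernel b M) (Φ Ψ : L2C) :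
    MemLp (kernelFun b Φ Ψ) 2 volume :=
  memLp_two_of_lintegral_sq (aestronglyMeasurable_kernelFun hb Φ Ψ)
    ((lintegral_kernelFun_le hb Φ Ψ).trans_lt (by finiteness))

theorem norm_toLp_kernelFun_le {b : ℝ → ℝ → ℂ} {M : ℝ} (hb : IsKernel b M) (Φ Ψ : L2C) :
    ‖(memLp_kernelFun hb Φ Ψ).toLp‖ ≤ M * ‖Φ‖ * ‖Ψ‖ := by
  have h : ‖(memLp_kernelFun hb Φ Ψ).toLp‖ₑ ^ 2 ≤ (ENNReal.ofReal M * (‖Φ‖ₑ * ‖Ψ‖ₑ)) ^ 2 := by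
    rw [enorm_sq_eq_lintegral, mul_pow, mul_pow]
    refine le_trans (le_of_eq ?_) (lintegral_kernelFun_le hb Φ Ψ)
    apply lintegral_congr_ae
    filter_upwards [(memLp_kernelFun hb Φ Ψ).coeFn_toLp] with ξ h
    rw [h]
  have h2 : ‖(memLp_kernelFun hb Φ Ψ).toLp‖ₑ ≤ ENNReal.ofReal M * (‖Φ‖ₑ * ‖Ψ‖ₑ) :=
    (ENNReal.pow_right_strictMono two_ne_zero).le_iff_le.1 h
  rw [← ofReal_norm, ← ofReal_norm, ← ofReal_norm, ← ENNReal.ofReal_mul (norm_nonneg _),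
    ← ENNReal.ofReal_mul hb.2.1,
    ENNReal.ofReal_le_ofReal_iff (by have := hb.2.1; positivity)] at h2
  rw [mul_assoc]
  exact h2

/-- The bounded bilinear operator `(Φ, Ψ) ↦ ∫ b(ξ, η) Φ(ξ - η) Ψ(η) dη` on `L²`. -/
def kernelOp {b : ℝ → ℝ → ℂ} {M : ℝ} (hb : IsKernel b M) : L2C →L[ℂ] L2C →L[ℂ] L2C :=
  LinearMap.mkContinuous₂
    (LinearMap.mk₂ ℂ (fun Φ Ψ => (memLp_kernelFun hb Φ Ψ).toLp)
      (by
        intro Φ Φ' Ψ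
        apply Lp.ext
        filter_upwards [(memLp_kernelFun hb (Φ + Φ') Ψ).coeFn_toLp,
          (memLp_kernelFun hb Φ Ψ).coeFn_toLp, (memLp_kernelFun hb Φ' Ψ).coeFn_toLp,
          Lp.coeFn_add (memLp_kernelFun hb Φ Ψ).toLp (memLp_kernelFun hb Φ' Ψ).toLp,
          ae_integrable_kernel hb Φ Ψ, ae_integrable_kernel hb Φ' Ψ] with ξ h1 h2 h3 h4 h5 h6
        rw [h1, h4, Pi.add_apply, h2, h3, kernelFun, kernelFun, kernelFun,
          ← integral_add h5 h6]
        apply integral_congr_ae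
        filter_upwards [ae_sub_left (Lp.coeFn_add Φ Φ') ξ] with η h
        rw [h, Pi.add_apply]
        ring)
      (by
        intro c Φ Ψ
        apply Lp.ext
        filter_upwards [(memLp_kernelFun hb (c • Φ) Ψ).coeFn_toLp,
          (memLp_kernelFun hb Φ Ψ).coeFn_toLp,
          Lp.coeFn_smul c (memLp_kernelFun hb Φ Ψ).toLp] with ξ h1 h2 h3
        rw [h1, h3, Pi.smul_apply, h2, kernelFun, kernelFun, ← integral_smul]
        apply integral_congr_ae
        filter_upwards [ae_sub_left (Lp.coeFn_smul c Φ) ξ] with η h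
        rw [h, Pi.smul_apply, smul_eq_mul, smul_eq_mul]
        ring)
      (by
        intro Φ Ψ Ψ'
        apply Lp.ext
        filter_upwards [(memLp_kernelFun hb Φ (Ψ + Ψ')).coeFn_toLp,
          (memLp_kernelFun hb Φ Ψ).coeFn_toLp, (memLp_kernelFun hb Φ Ψ').coeFn_toLp,
          Lp.coeFn_add (memLp_kernelFun hb Φ Ψ).toLp (memLp_kernelFun hb Φ Ψ').toLp,
          ae_integrable_kernel hb Φ Ψ, ae_integrable_kernel hb Φ Ψ'] with ξ h1 h2 h3 h4 h5 h6
        rw [h1, h4, Pi.add_apply, h2, h3, kernelFun, kernelFun, kernelFun,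
          ← integral_add h5 h6]
        apply integral_congr_ae
        filter_upwards [Lp.coeFn_add Ψ Ψ'] with η h
        rw [h, Pi.add_apply]
        ring)
      (by
        intro c Φ Ψ
        apply Lp.ext
        filter_upwards [(memLp_kernelFun hb Φ (c • Ψ)).coeFn_toLp,
          (memLp_kernelFun hb Φ Ψ).coeFn_toLp,
          Lp.coeFn_smul c (memLp_kernelFun hb Φ Ψ).toLp] with ξ h1 h2 h3
        rw [h1, h3, Pi.smul_apply, h2, kernelFun, kernelFun, ← integral_smul]
        apply integral_congr_ae
        filter_upwards [Lp.coeFn_smul c Ψ] with η h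
        rw [h, Pi.smul_apply, smul_eq_mul, smul_eq_mul]
        ring))
    M (norm_toLp_kernelFun_le hb)

theorem coeFn_kernelOp {b : ℝ → ℝ → ℂ} {M : ℝ} (hb : IsKernel b M) (Φ Ψ : L2C) :
    kernelOp hb Φ Ψ =ᵐ[volume] kernelFun b Φ Ψ :=
  (memLp_kernelFun hb Φ Ψ).coeFn_toLp

theorem norm_kernelOp_apply_le {b : ℝ → ℝ → ℂ} {M : ℝ} (hb : IsKernel b M) (Φ Ψ : L2C) :
    ‖kernelOp hb Φ Ψ‖ ≤ M * ‖Φ‖ * ‖Ψ‖ :=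
  norm_toLp_kernelFun_le hb Φ Ψ

/-! ### The Sobolev weight and a criterion for bounded kernels. -/

/-- The weight `⟨ξ⟩ = (1 + ξ²)^(1/2)`. -/
def jb (ξ : ℝ) : ℝ := √(1 + ξ ^ 2)

theorem jb_sq (ξ : ℝ) : jb ξ ^ 2 = 1 + ξ ^ 2 := Real.sq_sqrt (by positivity)

theorem jb_pos (ξ : ℝ) : 0 < jb ξ := Real.sqrt_pos.2 (by positivity)

theorem one_le_jb (ξ : ℝ) : 1 ≤ jb ξ := Real.one_le_sqrt.2 (by nlinarith [sq_nonneg ξ])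

theorem abs_le_jb (ξ : ℝ) : |ξ| ≤ jb ξ := Real.abs_le_sqrt (by linarith)

@[fun_prop]
theorem continuous_jb : Continuous jb := by unfold jb; fun_prop

theorem jb_neg (ξ : ℝ) : jb (-ξ) = jb ξ := by simp [jb]

/-- The mass of `⟨ξ⟩⁻²`. -/
theorem lintegral_jb_inv_sq : ∫⁻ ξ, ‖((jb ξ : ℂ))⁻¹‖ₑ ^ 2 = ENNReal.ofReal Real.pi := by
  rw [← integral_univ_inv_one_add_sq, ofReal_integral_eq_lintegral_ofReal
    integrable_inv_one_add_sq (Eventually.of_forall fun _ => by positivity)]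
  refine lintegral_congr fun ξ => ?_
  rw [← ofReal_norm, ← ENNReal.ofReal_pow (norm_nonneg _), norm_inv, Complex.norm_real,
    Real.norm_eq_abs, inv_pow, sq_abs, jb_sq]

theorem measurable_jb : Measurable jb := continuous_jb.measurable

/-- A sufficient condition for a kernel to be bounded on `L²`. -/
theorem isKernel_of_le {b : ℝ → ℝ → ℂ} {C : ℝ} (hC : 0 ≤ C)
    (hb : Measurable (Function.uncurry b))
    (h : ∀ ξ η, ‖b ξ η‖ ≤ C * ((jb (ξ - η))⁻¹ + (jb η)⁻¹)) : IsKernel b (4 * C) := by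
  refine ⟨hb, by positivity, fun ξ => ?_⟩
  have hm := measurable_jb
  calc ∫⁻ η, ‖b ξ η‖ₑ ^ 2
      ≤ ∫⁻ η, ENNReal.ofReal (2 * C ^ 2) *
          (‖((jb (ξ - η) : ℂ))⁻¹‖ₑ ^ 2 + ‖((jb η : ℂ))⁻¹‖ₑ ^ 2) := by
        refine lintegral_mono fun η => ?_
        simp only [← ofReal_norm]
        rw [← ENNReal.ofReal_pow (norm_nonneg _), ← ENNReal.ofReal_pow (norm_nonneg _),
          ← ENNReal.ofReal_pow (norm_nonneg _), ← ENNReal.ofReal_add (by positivity)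
          (by positivity), ← ENNReal.ofReal_mul (by positivity)]
        apply ENNReal.ofReal_le_ofReal
        have h1 := h ξ η
        simp only [norm_inv, Complex.norm_real, Real.norm_eq_abs, abs_of_pos (jb_pos _)]
        calc ‖b ξ η‖ ^ 2 ≤ (C * ((jb (ξ - η))⁻¹ + (jb η)⁻¹)) ^ 2 := by gcongr
          _ ≤ _ := by nlinarith [mul_nonneg (sq_nonneg C)
                        (sq_nonneg ((jb (ξ - η))⁻¹ - (jb η)⁻¹))]
    _ = ENNReal.ofReal (2 * C ^ 2) * (ENNReal.ofReal Real.pi + ENNReal.ofReal Real.pi) := by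
        rw [lintegral_const_mul' _ _ (by finiteness), lintegral_add_left (by fun_prop),
          lintegral_sub_left_eq_self (fun x => ‖((jb x : ℂ))⁻¹‖ₑ ^ 2) ξ, lintegral_jb_inv_sq]
    -- The left side is `4πC²`, and `π ≤ 4` gives the round constant `16C²`.
    _ ≤ ENNReal.ofReal (4 * C) ^ 2 := by
        rw [← ENNReal.ofReal_add Real.pi_pos.le Real.pi_pos.le,
          ← ENNReal.ofReal_mul (by positivity), ← ENNReal.ofReal_pow (by positivity)]
        apply ENNReal.ofReal_le_ofReal
        nlinarith [Real.pi_le_four, sq_nonneg C]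

/-! ### Products and convolutions under the Fourier transform. -/

/-- The inverse Fourier transform is self-adjoint. -/
theorem integral_schwartz_fourierInv_mul {h : ℝ → ℂ} (hh : Integrable h) (g : 𝓢(ℝ, ℂ)) :
    ∫ x, (𝓕⁻ g : 𝓢(ℝ, ℂ)) x • h x = ∫ x, g x • (𝓕⁻ h) x := by
  have hg : Integrable (fun x => g (-x)) := g.integrable.comp_neg
  have e := VectorFourier.integral_fourierIntegral_smul_eq_flip (L := innerₗ ℝ)
    (μ := (volume : Measure ℝ)) (ν := (volume : Measure ℝ))
    Real.continuous_fourierChar continuous_inner hg hh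
  have e1 : ∫ x, (𝓕⁻ g : 𝓢(ℝ, ℂ)) x • h x = ∫ x, (𝓕 fun y => g (-y)) x • h x := by
    congr 1
    ext x
    rw [SchwartzMap.fourierInv_coe, Real.fourierInv_eq_fourier_comp_neg]
  have e2 : ∫ x, g x • (𝓕⁻ h) x = ∫ x, g (-x) • (𝓕 h) x := by
    rw [← integral_neg_eq_self]
    congr 1
    ext x
    rw [Real.fourierInv_eq_fourier_neg, neg_neg]
  rw [e1, e2]
  simpa using! e

/-- The inverse Fourier transform on `L¹ ∩ L²` is given by the Fourier integral. -/
theorem fourierInv_toLp_ae_eq {h : ℝ → ℂ} (h1 : Integrable h) (h2 : MemLp h 2 volume) :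
    (𝓕⁻ h2.toLp : L2C) =ᵐ[volume] (𝓕⁻ h : ℝ → ℂ) := by
  have hcont : Continuous (𝓕⁻ h : ℝ → ℂ) := by
    rw [Real.fourierInv_eq_fourier_comp_neg]
    exact VectorFourier.fourierIntegral_continuous Real.continuous_fourierChar
      continuous_inner h1.comp_neg
  -- Both sides are locally integrable, so it suffices to test against smooth compactly supported
  -- functions. There the `L²` transform is computed by duality, as for tempered distributions.
  refine ae_eq_of_integral_contDiff_smul_eq ((Lp.memLp _).locallyIntegrable (by norm_num))
    hcont.locallyIntegrable fun g hg hgc => ?_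
  have hg1 : HasCompactSupport (Complex.ofRealCLM ∘ g) := hgc.comp_left rfl
  have hg2 : ContDiff ℝ ((⊤ : ℕ∞) : WithTop ℕ∞) (Complex.ofRealCLM ∘ g) :=
    Complex.ofRealCLM.contDiff.comp hg
  set φ : 𝓢(ℝ, ℂ) := hg1.toSchwartzMap hg2
  have hφ : ∀ x, φ x = (g x : ℂ) := fun x => rfl
  have e := congrArg (fun T : 𝓢'(ℝ, ℂ) => T φ) (Lp.fourierInv_toTemperedDistribution_eq h2.toLp)
  simp only [TemperedDistribution.fourierInv_apply, Lp.toTemperedDistribution_apply] at e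
  have e1 : ∫ x, (𝓕⁻ φ : 𝓢(ℝ, ℂ)) x • (h2.toLp : L2C) x = ∫ x, (𝓕⁻ φ : 𝓢(ℝ, ℂ)) x • h x := by
    apply integral_congr_ae
    filter_upwards [h2.coeFn_toLp] with x hx
    rw [hx]
  rw [e1, integral_schwartz_fourierInv_mul h1] at e
  simpa only [hφ, Complex.coe_smul] using! e.symm

theorem ae_eq_fourierInv_of_integrable {f : L2C} (h : Integrable (𝓕 f : L2C)) :
    f =ᵐ[volume] (𝓕⁻ ((𝓕 f : L2C) : ℝ → ℂ) : ℝ → ℂ) := by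
  have e := fourierInv_toLp_ae_eq h (Lp.memLp (𝓕 f : L2C))
  rwa [Lp.toLp_coeFn, FourierTransform.fourierInv_fourier_eq] at e

/-- The product with a function whose Fourier transform is integrable is a bounded operator
on `L²`. -/
theorem mul_eq_mulOp {f : L2C} (h : Integrable (𝓕 f : L2C)) (g : L2C) :
    IsBddSymbol (𝓕⁻ ((𝓕 f : L2C) : ℝ → ℂ)) ∧
      mul f g = mulOp (𝓕⁻ ((𝓕 f : L2C) : ℝ → ℂ)) g := by
  have hcont : Continuous (𝓕⁻ ((𝓕 f : L2C) : ℝ → ℂ)) := by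
    rw [Real.fourierInv_eq_fourier_comp_neg]
    exact VectorFourier.fourierIntegral_continuous Real.continuous_fourierChar
      continuous_inner h.comp_neg
  have hb : IsBddSymbol (𝓕⁻ ((𝓕 f : L2C) : ℝ → ℂ)) := by
    refine ⟨hcont.measurable, ∫ x, ‖(𝓕 f : L2C) x‖, fun x => ?_⟩
    rw [Real.fourierInv_eq_fourier_neg]
    exact VectorFourier.norm_fourierIntegral_le_integral_norm _ _ _ _ _
  have hae : (fun x => f x * g x) =ᵐ[volume] mulOp (𝓕⁻ ((𝓕 f : L2C) : ℝ → ℂ)) g := by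
    filter_upwards [coeFn_mulOp hb g, ae_eq_fourierInv_of_integrable h] with x h1 h2
    rw [h1, ← h2]
  have hm : MemLp (fun x => f x * g x) 2 volume := (memLp_congr_ae hae).2 (Lp.memLp _)
  refine ⟨hb, ?_⟩
  rw [mul, dif_pos hm]
  exact Lp.ext (hm.coeFn_toLp.trans hae)

/-- The kernel `1` is not admissible in `IsKernel`. Moving one weight from the first factor into the
kernel makes convolution with an `H¹` transform a bounded operator on `L²`. -/
theorem isKernel_jb_inv : IsKernel (fun ξ η => ((jb (ξ - η) : ℂ))⁻¹) (4 * 1) := by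
  have hm := measurable_jb
  refine isKernel_of_le zero_le_one ?_ fun ξ η => ?_
  · simp only [Function.uncurry_def]
    fun_prop
  · rw [norm_inv, Complex.norm_real, Real.norm_eq_abs, abs_of_pos (jb_pos _), one_mul]
    linarith [inv_pos.2 (jb_pos η)]

/-- One power of decay is square integrable on the line, so functions in `H¹` have integrable
transforms and act on `L²` by multiplication. -/
theorem integrable_of_ae_eq_jb_inv_mul {u : ℝ → ℂ} {Φ : L2C}
    (h : u =ᵐ[volume] fun ξ => ((jb ξ : ℂ))⁻¹ * Φ ξ) : Integrable u := by
  have h1 : MemLp (fun ξ => ((jb ξ : ℂ))⁻¹) 2 volume := by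
    refine memLp_two_of_lintegral_sq ?_ ?_
    · have := measurable_jb
      exact (by fun_prop : Measurable fun ξ => ((jb ξ : ℂ))⁻¹).aestronglyMeasurable
    · rw [lintegral_jb_inv_sq]
      finiteness
  exact (h1.integrable_mul (Lp.memLp Φ)).congr h.symm

/-- The Fourier transform of a product is the convolution of the Fourier transforms. -/
theorem fourier_mul_ae_eq {f : L2C} {Φ : L2C}
    (h : (𝓕 f : L2C) =ᵐ[volume] fun ξ => ((jb ξ : ℂ))⁻¹ * Φ ξ) (g : L2C) :
    (𝓕 (mul f g) : L2C) =ᵐ[volume] kernelFun (fun _ _ => 1) (𝓕 f : L2C) (𝓕 g : L2C) := by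
  have hint := integrable_of_ae_eq_jb_inv_mul h
  have hker : ∀ u : L2C, kernelFun (fun _ _ => 1) (𝓕 f : L2C) u =
      kernelFun (fun ξ η => ((jb (ξ - η) : ℂ))⁻¹) Φ u := by
    intro u
    rw [kernelFun_congr h (EventuallyEq.refl _ _)]
    funext ξ
    simp only [kernelFun, one_mul, mul_assoc]
  have main : ∀ g : L2C, 𝓕 (mulOp (𝓕⁻ ((𝓕 f : L2C) : ℝ → ℂ)) g) =
      kernelOp isKernel_jb_inv Φ (𝓕 g) := by
    intro g
    -- Both sides are continuous in `g`, so Schwartz functions suffice. For them the convolution is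
    -- integrable and the classical convolution theorem applies.
    refine DenseRange.induction_on (p := fun g : L2C => 𝓕 (mulOp (𝓕⁻ ((𝓕 f : L2C) : ℝ → ℂ)) g) =
      kernelOp isKernel_jb_inv Φ (𝓕 g))
      (SchwartzMap.denseRange_toLpCLM (p := 2) ENNReal.ofNat_ne_top) g ?_ ?_
    · apply isClosed_eq
      · exact (fourierCLM ℂ L2C).continuous.comp (mulOp _).continuous
      · exact (kernelOp isKernel_jb_inv Φ).continuous.comp (fourierCLM ℂ L2C).continuous
    · intro φ
      simp only [SchwartzMap.toLpCLM_apply]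
      set u : ℝ → ℂ := ((𝓕 f : L2C) : ℝ → ℂ) with hu
      set v : 𝓢(ℝ, ℂ) := 𝓕 φ with hv
      have hψ : (𝓕 (φ.toLp 2 volume) : L2C) = v.toLp 2 volume := SchwartzMap.toLp_fourier_eq φ
      set K : L2C := kernelOp isKernel_jb_inv Φ (𝓕 (φ.toLp 2 volume)) with hK
      set c : ℝ → ℂ := convolution u v (ContinuousLinearMap.mul ℂ ℂ) volume with hc
      have hKc : K =ᵐ[volume] c := by
        refine (coeFn_kernelOp _ _ _).trans (Eventually.of_forall fun ξ => ?_)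
        rw [← hker, hψ, kernelFun_congr (EventuallyEq.refl _ _) (v.coeFn_toLp 2 volume), hc,
          convolution_mul_swap]
        simp only [kernelFun, one_mul, hu]
      have hci : Integrable c := hint.integrable_convolution _ v.integrable
      have hc2 : MemLp c 2 volume := (memLp_congr_ae hKc).1 (Lp.memLp K)
      have hKe : K = hc2.toLp := Lp.ext (hKc.trans hc2.coeFn_toLp.symm)
      have hvφ : ∀ x, (𝓕 (v : ℝ → ℂ)) (-x) = φ x := by
        intro x
        rw [← Real.fourierInv_eq_fourier_neg, ← SchwartzMap.fourierInv_coe, hv,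
          FourierTransform.fourierInv_fourier_eq]
      have hm := mul_eq_mulOp hint (φ.toLp 2 volume)
      have e : mulOp (𝓕⁻ u) (φ.toLp 2 volume) = 𝓕⁻ K := by
        apply Lp.ext
        rw [hKe]
        filter_upwards [fourierInv_toLp_ae_eq hci hc2, coeFn_mulOp hm.1 (φ.toLp 2 volume),
          φ.coeFn_toLp 2 volume] with x h1 h2 h3
        rw [h1, h2, h3, Real.fourierInv_eq_fourier_neg, Real.fourierInv_eq_fourier_neg, hc,
          Real.fourier_mul_convolution_eq hint v.integrable, hvφ]
      rw [e, FourierTransform.fourier_fourierInv_eq]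
  have hm := mul_eq_mulOp hint g
  rw [hm.2, main, hker]
  exact coeFn_kernelOp _ _ _

/-! ### A product rule for strongly differentiable operator families. -/

theorem integrableOn_apply {S : ℝ → L2C →L[ℂ] L2C} {C : ℝ}
    (hS : Continuous fun q : ℝ × L2C => S q.1 q.2) (hSC : ∀ t x, ‖S t x‖ ≤ C * ‖x‖)
    {a : ℝ → L2C} {μ : Measure ℝ} (ha : Integrable a μ) : Integrable (fun s => S s (a s)) μ := by
  refine (ha.norm.const_mul C).mono
    (hS.comp_aestronglyMeasurable (aestronglyMeasurable_id.prodMk ha.1))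
    (Eventually.of_forall fun s => (hSC s _).trans ?_)
  rw [Real.norm_eq_abs]
  exact le_abs_self _

/-- The order of integration in an integral over the triangle `0 < s < r < t`. -/
theorem integral_triangle_swap {S' : ℝ → L2C →L[ℂ] L2C} {C : ℝ}
    (hS' : Continuous fun q : ℝ × L2C => S' q.1 q.2) (hSC' : ∀ t x, ‖S' t x‖ ≤ C * ‖x‖)
    {a : ℝ → L2C} {t : ℝ} (ht : 0 ≤ t) (ha : IntegrableOn a (Set.Ioc 0 t)) :
    ∫ s in (0 : ℝ)..t, ∫ r in s..t, S' r (a s) =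
      ∫ r in (0 : ℝ)..t, S' r (∫ s in (0 : ℝ)..r, a s) := by
  set μ : Measure ℝ := volume.restrict (Set.Ioc 0 t) with hμ
  set D : Set (ℝ × ℝ) := {q | q.1 < q.2} with hD
  have hDm : MeasurableSet D := measurableSet_lt measurable_fst measurable_snd
  have hint : Integrable (Function.uncurry fun s r => D.indicator
      (fun q : ℝ × ℝ => S' q.2 (a q.1)) (s, r)) (μ.prod μ) := by
    have h1 : Integrable (fun q : ℝ × ℝ => S' q.2 (a q.1)) (μ.prod μ) := by
      have h2 : Integrable (fun q : ℝ × ℝ => a q.1) (μ.prod μ) := ha.comp_fst μ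
      refine (h2.norm.const_mul C).mono
        (hS'.comp_aestronglyMeasurable (measurable_snd.aestronglyMeasurable.prodMk h2.1))
        (Eventually.of_forall fun s => (hSC' _ _).trans ?_)
      rw [Real.norm_eq_abs]
      exact le_abs_self _
    exact h1.indicator hDm
  have e := integral_integral_swap hint
  have e1 : ∫ s in (0 : ℝ)..t, ∫ r in s..t, S' r (a s) =
      ∫ s, ∫ r, D.indicator (fun q : ℝ × ℝ => S' q.2 (a q.1)) (s, r) ∂μ ∂μ := by
    rw [intervalIntegral.integral_of_le ht]
    refine setIntegral_congr_fun measurableSet_Ioc fun s hs => ?_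
    have h3 : (fun r => D.indicator (fun q : ℝ × ℝ => S' q.2 (a q.1)) (s, r)) =
        (Set.Ioi s).indicator fun r => S' r (a s) := by
      funext r
      simp only [Set.indicator, hD, Set.mem_ofPred_eq, Set.mem_Ioi]
    have h4 : Set.Ioc 0 t ∩ Set.Ioi s = Set.Ioc s t := by
      ext r
      simp only [Set.mem_inter_iff, Set.mem_Ioc, Set.mem_Ioi]
      exact ⟨fun h => ⟨h.2, h.1.2⟩, fun h => ⟨⟨hs.1.trans h.1, h.2⟩, h.1⟩⟩
    simp only [h3]
    rw [intervalIntegral.integral_of_le hs.2, hμ, setIntegral_indicator measurableSet_Ioi, h4]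
  have e2 : ∫ r in (0 : ℝ)..t, S' r (∫ s in (0 : ℝ)..r, a s) =
      ∫ r, ∫ s, D.indicator (fun q : ℝ × ℝ => S' q.2 (a q.1)) (s, r) ∂μ ∂μ := by
    rw [intervalIntegral.integral_of_le ht]
    refine setIntegral_congr_fun measurableSet_Ioc fun r hr => ?_
    have h3 : (fun s => D.indicator (fun q : ℝ × ℝ => S' q.2 (a q.1)) (s, r)) =
        (Set.Iio r).indicator fun s => S' r (a s) := by
      funext s
      simp only [Set.indicator, hD, Set.mem_ofPred_eq, Set.mem_Iio]
    have h4 : Set.Ioc 0 t ∩ Set.Iio r = Set.Ioo 0 r := by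
      ext s
      simp only [Set.mem_inter_iff, Set.mem_Ioc, Set.mem_Iio, Set.mem_Ioo]
      exact ⟨fun h => ⟨h.1.1, h.2⟩, fun h => ⟨⟨h.1, h.2.le.trans hr.2⟩, h.2⟩⟩
    simp only [h3]
    rw [hμ, setIntegral_indicator measurableSet_Iio, h4, ← integral_Ioc_eq_integral_Ioo,
      intervalIntegral.integral_of_le hr.1.le, ContinuousLinearMap.integral_comp_comm]
    exact ha.mono_set (Set.Ioc_subset_Ioc_right hr.2)
  rw [e1, e2, e]

/-- The product rule for `S(t) A(t)`, where `S` is strongly continuously differentiable and `A` is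
the integral of an integrable function. -/
theorem apply_integral_eq {S S' : ℝ → L2C →L[ℂ] L2C} {C : ℝ}
    (hS : Continuous fun q : ℝ × L2C => S q.1 q.2)
    (hS' : Continuous fun q : ℝ × L2C => S' q.1 q.2)
    (hSC : ∀ t x, ‖S t x‖ ≤ C * ‖x‖) (hSC' : ∀ t x, ‖S' t x‖ ≤ C * ‖x‖)
    (hder : ∀ t x, HasDerivAt (fun r => S r x) (S' t x) t) {a : ℝ → L2C} (A₀ : L2C) {t : ℝ}
    (ht : 0 ≤ t) (ha : IntegrableOn a (Set.Ioc 0 t)) :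
    S t (A₀ + ∫ s in (0 : ℝ)..t, a s) =
      S 0 A₀ + ∫ s in (0 : ℝ)..t, (S s (a s) + S' s (A₀ + ∫ r in (0 : ℝ)..s, a r)) := by
  have hai : IntervalIntegrable a volume 0 t := (intervalIntegrable_iff_integrableOn_Ioc_of_le ht).2 ha
  have hc : ∀ x, Continuous fun r => S' r x := fun x =>
    hS'.comp (by fun_prop : Continuous fun r : ℝ => (r, x))
  have h0 : ∀ x s, ∫ r in s..t, S' r x = S t x - S s x := fun x s =>
    intervalIntegral.integral_eq_sub_of_hasDerivAt (fun r _ => hder r x)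
      ((hc x).intervalIntegrable _ _)
  have i1 : IntervalIntegrable (fun s => S s (a s)) volume 0 t :=
    (intervalIntegrable_iff_integrableOn_Ioc_of_le ht).2 (integrableOn_apply hS hSC ha)
  have iT : IntervalIntegrable (fun s => S t (a s)) volume 0 t :=
    (intervalIntegrable_iff_integrableOn_Ioc_of_le ht).2 ((S t).integrable_comp ha)
  have i2 : IntervalIntegrable (fun s => S' s A₀) volume 0 t := (hc A₀).intervalIntegrable _ _
  have i3 : IntervalIntegrable (fun s => S' s (∫ r in (0 : ℝ)..s, a r)) volume 0 t := by
    apply ContinuousOn.intervalIntegrable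
    exact hS'.comp_continuousOn (continuousOn_id.prodMk
      (intervalIntegral.continuousOn_primitive_interval' hai (by simp)))
  -- Replacing `S t` by `S s + ∫ₛᵗ S'` under the integral avoids differentiating the primitive of
  -- `a`, which is merely integrable. Exchanging the order of integration then produces the term
  -- with `S'`.
  have e1 : S t (∫ s in (0 : ℝ)..t, a s) =
      ∫ s in (0 : ℝ)..t, (S s (a s) + ∫ r in s..t, S' r (a s)) := by
    rw [← ContinuousLinearMap.intervalIntegral_comp_comm _ hai]
    exact intervalIntegral.integral_congr fun s _ => by simp only [h0]; abel
  have i4 : IntervalIntegrable (fun s => ∫ r in s..t, S' r (a s)) volume 0 t := by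
    simp only [h0]
    exact iT.sub i1
  have e2 : ∫ s in (0 : ℝ)..t, (S s (a s) + S' s (A₀ + ∫ r in (0 : ℝ)..s, a r)) =
      ∫ s in (0 : ℝ)..t, (S s (a s) + (S' s A₀ + S' s (∫ r in (0 : ℝ)..s, a r))) := by
    simp only [map_add]
  rw [map_add, e1, e2, intervalIntegral.integral_add i1 i4,
    intervalIntegral.integral_add i1 (i2.add i3), intervalIntegral.integral_add i2 i3,
    integral_triangle_swap hS' hSC' ht ha, h0]
  abel

/-! ### Ordinary differential equations with locally Lipschitz fields. -/

variable {X : Type*} [NormedAddCommGroup X] [NormedSpace ℝ X]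

/-- Vector fields that are continuous, and bounded and Lipschitz continuous on bounded sets,
uniformly in time. -/
structure IsLocLipField (F : ℝ → X → X) : Prop where
  continuous : Continuous fun q : ℝ × X => F q.1 q.2
  lipschitz : ∀ R : ℝ, ∃ K : NNReal, ∀ t, LipschitzOnWith K (F t) (Metric.closedBall 0 R)
  bounded : ∀ R : ℝ, ∃ L : NNReal, ∀ t, ∀ x ∈ Metric.closedBall 0 R, ‖F t x‖ ≤ L

theorem IsLocLipField.exists_solution [CompleteSpace X] {F : ℝ → X → X} (hF : IsLocLipField F)
    (x₀ : X) : ∃ T : ℝ, 0 < T ∧ ∃ U : ℝ → X, U 0 = x₀ ∧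
      ∀ t ∈ Set.Icc 0 T, HasDerivWithinAt U (F t (U t)) (Set.Icc 0 T) t := by
  obtain ⟨K, hK⟩ := hF.lipschitz (‖x₀‖ + 1)
  obtain ⟨L, hL⟩ := hF.bounded (‖x₀‖ + 1)
  have hsub : Metric.closedBall x₀ 1 ⊆ Metric.closedBall (0 : X) (‖x₀‖ + 1) := by
    apply Metric.closedBall_subset_closedBall'
    rw [dist_zero_right, add_comm]
  -- At speed at most `L`, the unit ball around `x₀` is not left within this time; the `+ 1` covers
  -- `L = 0`.
  have hT : 0 < 1 / ((L : ℝ) + 1) := by positivity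
  have hpl : IsPicardLindelof F (tmin := 0) (tmax := 1 / ((L : ℝ) + 1)) ⟨0, le_rfl, hT.le⟩
      x₀ 1 0 L K := by
    refine ⟨fun t _ => (hK t).mono hsub, fun x _ => ?_, fun t _ x hx => hL t x (hsub hx), ?_⟩
    · exact (hF.continuous.comp (by fun_prop : Continuous fun t : ℝ => (t, x))).continuousOn
    · simp only [sub_zero, max_eq_left hT.le, NNReal.coe_one, NNReal.coe_zero]
      rw [mul_one_div, div_le_one (by positivity)]
      linarith
  obtain ⟨U, h0, hU⟩ := hpl.exists_eq_forall_mem_Icc_hasDerivWithinAt₀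
  exact ⟨_, hT, U, h0, hU⟩

theorem IsLocLipField.eq_integral [CompleteSpace X] {F : ℝ → X → X} (hF : IsLocLipField F) {T : ℝ}
    {U : ℝ → X} (hU : ∀ t ∈ Set.Icc 0 T, HasDerivWithinAt U (F t (U t)) (Set.Icc 0 T) t) {t : ℝ}
    (ht : t ∈ Set.Icc 0 T) : U t = U 0 + ∫ s in (0 : ℝ)..t, F s (U s) := by
  have hUc : ContinuousOn U (Set.Icc 0 T) := fun s hs => (hU s hs).continuousWithinAt
  have hFc : ContinuousOn (fun s => F s (U s)) (Set.Icc 0 T) :=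
    hF.continuous.comp_continuousOn (continuousOn_id.prodMk hUc)
  have hsub : Set.Icc 0 t ⊆ Set.Icc 0 T := Set.Icc_subset_Icc_right ht.2
  rw [intervalIntegral.integral_eq_sub_of_hasDeriv_right_of_le ht.1 (hUc.mono hsub)
    (fun s hs => ?_)
    ((hFc.mono (by rwa [Set.uIcc_of_le ht.1])).intervalIntegrable)]
  · abel
  · refine (hU s (hsub (Set.Ioo_subset_Icc_self hs))).mono_of_mem_nhdsWithin ?_
    exact mem_nhdsWithin_of_mem_nhds (Icc_mem_nhds hs.1 (hs.2.trans_le ht.2))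

/-- Two continuous curves on a compact interval stay in a common ball, where one Lipschitz constant
serves all times and Grönwall's argument applies. -/
theorem IsLocLipField.eqOn {F : ℝ → X → X} (hF : IsLocLipField F) {T : ℝ} {U V : ℝ → X}
    (hU : ∀ t ∈ Set.Icc 0 T, HasDerivWithinAt U (F t (U t)) (Set.Icc 0 T) t)
    (hV : ∀ t ∈ Set.Icc 0 T, HasDerivWithinAt V (F t (V t)) (Set.Icc 0 T) t)
    (h : U 0 = V 0) : Set.EqOn U V (Set.Icc 0 T) := by
  have hUc : ContinuousOn U (Set.Icc 0 T) := fun s hs => (hU s hs).continuousWithinAt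
  have hVc : ContinuousOn V (Set.Icc 0 T) := fun s hs => (hV s hs).continuousWithinAt
  obtain ⟨R₁, h₁⟩ := isCompact_Icc.exists_bound_of_continuousOn hUc
  obtain ⟨R₂, h₂⟩ := isCompact_Icc.exists_bound_of_continuousOn hVc
  obtain ⟨K, hK⟩ := hF.lipschitz (max R₁ R₂)
  have hnhds : ∀ t ∈ Set.Ico 0 T, Set.Icc 0 T ∈ 𝓝[≥] t := fun t ht =>
    mem_of_superset (Icc_mem_nhdsGE ht.2) (Set.Icc_subset_Icc_left ht.1)
  refine ODE_solution_unique_of_mem_Icc_right (v := F)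
    (s := fun _ => Metric.closedBall 0 (max R₁ R₂)) (fun t _ => hK t) hUc
    (fun t ht => (hU t (Set.Ico_subset_Icc_self ht)).mono_of_mem_nhdsWithin (hnhds t ht))
    (fun t ht => ?_) hVc
    (fun t ht => (hV t (Set.Ico_subset_Icc_self ht)).mono_of_mem_nhdsWithin (hnhds t ht))
    (fun t ht => ?_) h
  · rw [mem_closedBall_zero_iff]
    exact (h₁ t (Set.Ico_subset_Icc_self ht)).trans (le_max_left _ _)
  · rw [mem_closedBall_zero_iff]
    exact (h₂ t (Set.Ico_subset_Icc_self ht)).trans (le_max_right _ _)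

/-- Solutions of the integral equation in the sense of almost every time are unique. -/
theorem IsLocLipField.ae_eq [CompleteSpace X] {F : ℝ → X → X} (hF : IsLocLipField F) {T T' : ℝ}
    (hT' : T' ≤ T) {U V : ℝ → X}
    (hU : ∀ t ∈ Set.Icc 0 T, HasDerivWithinAt U (F t (U t)) (Set.Icc 0 T) t)
    (hVi : Integrable (fun s => F s (V s)) (timeMeasure T'))
    (hV : ∀ᵐ t ∂timeMeasure T', V t = U 0 + ∫ s in (0 : ℝ)..t, F s (V s)) :
    ∀ᵐ t ∂timeMeasure T', V t = U t := by
  obtain hneg | hpos := le_or_gt T' 0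
  · simp [timeMeasure, Set.Ioo_eq_empty (not_lt.2 hneg)]
  -- `W` is the continuous representative of `V`. Since `V = W` almost everywhere, `W` solves the
  -- integral equation at every time and is therefore differentiable.
  set W : ℝ → X := fun t => U 0 + ∫ s in (0 : ℝ)..t, F s (V s) with hW
  have hi : IntervalIntegrable (fun s => F s (V s)) volume 0 T' :=
    (intervalIntegrable_iff_integrableOn_Ioo_of_le hpos.le).2 hVi
  have hWc : ContinuousOn W (Set.Icc 0 T') := by
    have := intervalIntegral.continuousOn_primitive_interval' hi (a := 0) (by simp)
    rw [Set.uIcc_of_le hpos.le] at this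
    exact continuousOn_const.add this
  have hWe : ∀ t ∈ Set.Icc 0 T', W t = U 0 + ∫ s in (0 : ℝ)..t, F s (W s) := by
    intro t ht
    change U 0 + _ = _
    congr 1
    rw [intervalIntegral.integral_of_le ht.1, intervalIntegral.integral_of_le ht.1,
      integral_Ioc_eq_integral_Ioo, integral_Ioc_eq_integral_Ioo]
    apply integral_congr_ae
    have := ae_restrict_of_ae_restrict_of_subset (Set.Ioo_subset_Ioo_right ht.2) hV
    filter_upwards [this] with s hs
    rw [hs]
  have hFc : ContinuousOn (fun s => F s (W s)) (Set.Icc 0 T') :=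
    hF.continuous.comp_continuousOn (continuousOn_id.prodMk hWc)
  have hWd : ∀ t ∈ Set.Icc 0 T', HasDerivWithinAt W (F t (W t)) (Set.Icc 0 T') t := by
    intro t ht
    have hd : HasDerivWithinAt (fun u => U 0 + ∫ s in (0 : ℝ)..u, F s (W s)) (F t (W t))
        (Set.Icc 0 T') t := by
      have : Fact (t ∈ Set.Icc 0 T') := ⟨ht⟩
      refine (intervalIntegral.integral_hasDerivWithinAt_right ?_ ?_ (hFc t ht)).const_add _
      · apply ContinuousOn.intervalIntegrable
        rw [Set.uIcc_of_le ht.1]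
        exact hFc.mono (Set.Icc_subset_Icc_right ht.2)
      · exact hFc.stronglyMeasurableAtFilter_nhdsWithin measurableSet_Icc t
    exact hd.congr hWe (hWe t ht)
  have hUd : ∀ t ∈ Set.Icc 0 T', HasDerivWithinAt U (F t (U t)) (Set.Icc 0 T') t := fun t ht =>
    (hU t ⟨ht.1, ht.2.trans hT'⟩).mono (Set.Icc_subset_Icc_right hT')
  have hEq := hF.eqOn hWd hUd (by simp [hW])
  filter_upwards [hV, ae_restrict_mem measurableSet_Ioo] with t h1 h2
  rw [h1]
  exact hEq (Set.Ioo_subset_Icc_self h2)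

/-! ### Weighted oscillating multipliers and their time derivatives. -/

theorem continuous_uncurry_of_norm_le {S : ℝ → L2C →L[ℂ] L2C} {C : ℝ}
    (hc : ∀ x, Continuous fun t => S t x) (hC : ∀ t x, ‖S t x‖ ≤ C * ‖x‖) :
    Continuous fun q : ℝ × L2C => S q.1 q.2 := by
  rw [continuous_iff_continuousAt]
  rintro ⟨t₀, x₀⟩
  rw [ContinuousAt, tendsto_iff_norm_sub_tendsto_zero]
  refine squeeze_zero (g := fun q : ℝ × L2C => C * ‖q.2 - x₀‖ + ‖S q.1 x₀ - S t₀ x₀‖)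
    (fun _ => norm_nonneg _) (fun q => ?_) ?_
  · calc ‖S q.1 q.2 - S t₀ x₀‖ = ‖S q.1 (q.2 - x₀) + (S q.1 x₀ - S t₀ x₀)‖ := by
          rw [map_sub]; congr 1; abel
      _ ≤ _ := (norm_add_le _ _).trans (by gcongr; exact hC _ _)
  · have h : Continuous fun q : ℝ × L2C => C * ‖q.2 - x₀‖ + ‖S q.1 x₀ - S t₀ x₀‖ := by
      have h1 : Continuous fun q : ℝ × L2C => S q.1 x₀ := (hc x₀).comp continuous_fst
      fun_prop
    have h2 := h.tendsto (t₀, x₀)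
    simpa using h2

/-- The symbol `⟨ξ⟩⁻ⁿ`. -/
def jbInv (n : ℕ) (ξ : ℝ) : ℂ := ((jb ξ : ℂ)⁻¹) ^ n

theorem measurable_jbInv (n : ℕ) : Measurable (jbInv n) := by
  have := measurable_jb
  unfold jbInv
  fun_prop

theorem norm_jbInv (n : ℕ) (ξ : ℝ) : ‖jbInv n ξ‖ = ((jb ξ)⁻¹) ^ n := by
  rw [jbInv, norm_pow, norm_inv, Complex.norm_real, Real.norm_eq_abs, abs_of_pos (jb_pos _)]

theorem norm_jbInv_le_one (n : ℕ) (ξ : ℝ) : ‖jbInv n ξ‖ ≤ 1 := by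
  rw [norm_jbInv]
  exact pow_le_one₀ (inv_pos.2 (jb_pos ξ)).le (inv_le_one_of_one_le₀ (one_le_jb ξ))

theorem isBddSymbol_jbInv (n : ℕ) : IsBddSymbol (jbInv n) :=
  ⟨measurable_jbInv n, 1, norm_jbInv_le_one n⟩

theorem jbInv_ne_zero (n : ℕ) (ξ : ℝ) : jbInv n ξ ≠ 0 := by
  rw [← norm_pos_iff, norm_jbInv]
  have := jb_pos ξ
  positivity

/-- The operator with symbol `m(ξ) exp(i t p(ξ))`. -/
def expOp (m : ℝ → ℂ) (p : ℝ → ℝ) (t : ℝ) : L2C →L[ℂ] L2C :=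
  mulOp fun ξ => m ξ * Complex.exp (Complex.I * ((t * p ξ : ℝ) : ℂ))

theorem norm_exp_I_mul_real (x : ℝ) : ‖Complex.exp (Complex.I * (x : ℂ))‖ = 1 := by
  rw [mul_comm]
  exact Complex.norm_exp_ofReal_mul_I x

section expOp

variable {m n : ℝ → ℂ} {p : ℝ → ℝ} {C D : ℝ}

theorem isBddSymbol_exp (hm : IsBddSymbol m) (hp : Measurable p) (t : ℝ) :
    IsBddSymbol fun ξ => m ξ * Complex.exp (Complex.I * ((t * p ξ : ℝ) : ℂ)) := by
  refine hm.mul ⟨?_, 1, fun ξ => (norm_exp_I_mul_real _).le⟩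
  fun_prop

theorem norm_expOp_apply_le (hm : Measurable m) (hC : ∀ ξ, ‖m ξ‖ ≤ C) (hp : Measurable p)
    (t : ℝ) (x : L2C) : ‖expOp m p t x‖ ≤ C * ‖x‖ := by
  apply norm_mulOp_apply_le (by fun_prop)
  intro ξ
  rw [norm_mul, norm_exp_I_mul_real, mul_one]
  exact hC ξ

theorem continuous_expOp (hm : IsBddSymbol m) (hp : Measurable p) (x : L2C) :
    Continuous fun t => expOp m p t x := by
  obtain ⟨hmm, C, hC⟩ := hm
  rw [continuous_iff_continuousAt]
  intro t
  have hb : ∀ (t ξ : ℝ), ‖m ξ * Complex.exp (Complex.I * ((t * p ξ : ℝ) : ℂ))‖ ≤ C := by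
    intro t ξ
    rw [norm_mul, norm_exp_I_mul_real, mul_one]
    exact hC ξ
  refine tendsto_mulOp (C := C) (fun t => by fun_prop) (by fun_prop) hb (hb t) (fun ξ => ?_) x
  have : Continuous fun t : ℝ => m ξ * Complex.exp (Complex.I * ((t * p ξ : ℝ) : ℂ)) := by
    fun_prop
  exact this.tendsto t

theorem continuous_uncurry_expOp (hm : IsBddSymbol m) (hp : Measurable p) :
    Continuous fun q : ℝ × L2C => expOp m p q.1 q.2 := by
  obtain ⟨C, hC⟩ := hm.2
  exact continuous_uncurry_of_norm_le (continuous_expOp hm hp) (norm_expOp_apply_le hm.1 hC hp)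

theorem expOp_expOp (hm : IsBddSymbol m) (hn : IsBddSymbol n) (hp : Measurable p) (s t : ℝ)
    (x : L2C) : expOp m p s (expOp n p t x) = expOp (fun ξ => m ξ * n ξ) p (s + t) x := by
  rw [expOp, expOp, mulOp_mulOp (isBddSymbol_exp hm hp s) (isBddSymbol_exp hn hp t), expOp]
  congr 2
  funext ξ
  rw [add_mul, Complex.ofReal_add, mul_add, Complex.exp_add]
  ring

theorem expOp_zero (m : ℝ → ℂ) (p : ℝ → ℝ) : expOp m p 0 = mulOp m := by
  simp [expOp]

theorem mulOp_eq_expOp (m : ℝ → ℂ) (p : ℝ → ℝ) (x : L2C) : mulOp m x = expOp m p 0 x := by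
  rw [expOp_zero]

/-- The derivative in time of the operator with symbol `m(ξ) exp(i t p(ξ))`. -/
theorem hasDerivAt_expOp (hm : IsBddSymbol m) (hp : Measurable p)
    (hmp : ∀ ξ, ‖m ξ * p ξ‖ ≤ C) (x : L2C) (t : ℝ) :
    HasDerivAt (fun r => expOp m p r x) (expOp (fun ξ => m ξ * (Complex.I * p ξ)) p t x) t := by
  have hmm := hm.1
  have hd : ∀ ξ : ℝ, HasDerivAt (fun r : ℝ => Complex.exp (Complex.I * ((r * p ξ : ℝ) : ℂ)))
      (Complex.I * p ξ * Complex.exp (Complex.I * ((t * p ξ : ℝ) : ℂ))) t := by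
    intro ξ
    have h1 : HasDerivAt (fun r : ℝ => Complex.I * ((r * p ξ : ℝ) : ℂ)) (Complex.I * p ξ) t := by
      have := ((hasDerivAt_id t).mul_const (p ξ)).ofReal_comp.const_mul Complex.I
      simpa using this
    have h2 := h1.cexp
    rwa [mul_comm] at h2
  -- From `|exp(ia) - 1| ≤ |a|`. The difference quotients of the symbol are thus dominated by `|m p|
  -- ≤ C`, which gives strong differentiability although `p` itself may be unbounded.
  have hLip : ∀ (r ξ : ℝ), ‖Complex.exp (Complex.I * ((r * p ξ : ℝ) : ℂ)) -
      Complex.exp (Complex.I * ((t * p ξ : ℝ) : ℂ))‖ ≤ |r - t| * |p ξ| := by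
    intro r ξ
    have h1 : Complex.exp (Complex.I * ((r * p ξ : ℝ) : ℂ)) =
        Complex.exp (Complex.I * ((t * p ξ : ℝ) : ℂ)) *
          Complex.exp (Complex.I * (((r - t) * p ξ : ℝ) : ℂ)) := by
      rw [← Complex.exp_add]
      congr 1
      push_cast
      ring
    rw [h1, ← mul_sub_one, norm_mul, norm_exp_I_mul_real, one_mul, ← abs_mul]
    exact Real.norm_exp_I_mul_ofReal_sub_one_le
  rw [hasDerivAt_iff_tendsto_slope]
  have hslope : slope (fun r => expOp m p r x) t = fun r => mulOp (fun ξ => m ξ *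
      ((((r - t)⁻¹ : ℝ) : ℂ) * (Complex.exp (Complex.I * ((r * p ξ : ℝ) : ℂ)) -
        Complex.exp (Complex.I * ((t * p ξ : ℝ) : ℂ))))) x := by
    funext r
    rw [slope_def_module]
    have hb : IsBddSymbol (fun ξ => m ξ *
        ((((r - t)⁻¹ : ℝ) : ℂ) * (Complex.exp (Complex.I * ((r * p ξ : ℝ) : ℂ)) -
        Complex.exp (Complex.I * ((t * p ξ : ℝ) : ℂ))))) := by
      refine hm.mul ⟨by fun_prop, ‖(((r - t)⁻¹ : ℝ) : ℂ)‖ * 2, fun ξ => ?_⟩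
      rw [norm_mul]
      gcongr
      refine (norm_sub_le _ _).trans ?_
      rw [norm_exp_I_mul_real, norm_exp_I_mul_real]
      norm_num
    apply eq_mulOp_of_ae_eq hb
    filter_upwards [Lp.coeFn_smul (r - t)⁻¹ (expOp m p r x - expOp m p t x),
      Lp.coeFn_sub (expOp m p r x) (expOp m p t x),
      coeFn_mulOp (isBddSymbol_exp hm hp r) x, coeFn_mulOp (isBddSymbol_exp hm hp t) x]
      with ξ h1 h2 h3 h4
    rw [h1, Pi.smul_apply, h2, Pi.sub_apply, expOp, expOp, h3, h4, Complex.real_smul]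
    ring
  rw [hslope]
  refine tendsto_mulOp (C := C) (fun r => by fun_prop) (by fun_prop) (fun r ξ => ?_)
    (fun ξ => ?_) (fun ξ => ?_) x
  · refine le_trans ?_ (hmp ξ)
    rw [norm_mul, norm_mul, norm_mul, Complex.norm_real, Complex.norm_real, Real.norm_eq_abs,
      Real.norm_eq_abs]
    gcongr
    obtain rfl | hne := eq_or_ne r t
    · simp
    · rw [abs_inv, inv_mul_le_iff₀ (abs_pos.2 (sub_ne_zero.2 hne))]
      exact hLip r ξ
  · rw [norm_mul, norm_exp_I_mul_real, mul_one]
    change ‖m ξ * (Complex.I * p ξ)‖ ≤ C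
    rw [mul_left_comm, norm_mul, Complex.norm_I, one_mul]
    exact hmp ξ
  · have h := hasDerivAt_iff_tendsto_slope.1 (hd ξ)
    have h1 := h.const_mul (m ξ)
    have h2 : (fun r => m ξ * slope (fun r : ℝ => Complex.exp (Complex.I * ((r * p ξ : ℝ) : ℂ)))
        t r) = fun r => m ξ * ((((r - t)⁻¹ : ℝ) : ℂ) *
        (Complex.exp (Complex.I * ((r * p ξ : ℝ) : ℂ)) -
        Complex.exp (Complex.I * ((t * p ξ : ℝ) : ℂ)))) := by
      funext r
      rw [slope_def_module, Complex.real_smul]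
    rw [h2] at h1
    simpa only [mul_assoc] using h1

end expOp

/-! ### The abstract semilinear equation and its interaction picture. -/

/-- A semilinear equation `∂ₜ Φ = i p Φ + B(Φ, Φ)` on the Fourier side, with a real symbol `p` of
order one. -/
structure SemilinearData where
  /-- the real dispersion symbol -/
  p : ℝ → ℝ
  /-- the kernel of the quadratic term -/
  b : ℝ → ℝ → ℂ
  /-- the bound of the symbol -/
  C : ℝ
  /-- the bound of the kernel -/
  M : ℝ
  measurable_p : Measurable p
  norm_p_le : ∀ ξ, |p ξ| ≤ C * jb ξ
  isKernel : IsKernel b M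

namespace SemilinearData

variable (d : SemilinearData)

/-- The quadratic term. -/
def quad (Φ : L2C) : L2C := kernelOp d.isKernel Φ Φ

/-- The unitary group generated by the linear part. -/
def grp (t : ℝ) : L2C →L[ℂ] L2C := expOp (fun _ => 1) d.p t

/-- The vector field of the equation in the interaction picture. -/
def field (t : ℝ) (U : L2C) : L2C := d.grp (-t) (d.quad (d.grp t U))

/-- The weighted right-hand side `⟨ξ⟩⁻³ (i p Φ + B(Φ, Φ))`, a bounded map. -/
def vel (Φ : L2C) : L2C :=
  mulOp (fun ξ => jbInv 3 ξ * (Complex.I * d.p ξ)) Φ + mulOp (jbInv 3) (d.quad Φ)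

theorem C_nonneg : 0 ≤ d.C := by
  have h := (abs_nonneg _).trans (d.norm_p_le 0)
  exact nonneg_of_mul_nonneg_left h (jb_pos 0)

theorem isBddSymbol_one : IsBddSymbol fun _ => (1 : ℂ) := ⟨measurable_const, 1, by simp⟩

theorem norm_jbInv_mul_p_le (n : ℕ) (ξ : ℝ) : ‖jbInv (n + 1) ξ * d.p ξ‖ ≤ d.C := by
  rw [norm_mul, norm_jbInv, Complex.norm_real, Real.norm_eq_abs]
  have h1 : ((jb ξ)⁻¹) ^ n ≤ 1 :=
    pow_le_one₀ (inv_pos.2 (jb_pos ξ)).le (inv_le_one_of_one_le₀ (one_le_jb ξ))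
  have h2 := jb_pos ξ
  calc (jb ξ)⁻¹ ^ (n + 1) * |d.p ξ| ≤ (jb ξ)⁻¹ ^ (n + 1) * (d.C * jb ξ) := by
        gcongr; exact d.norm_p_le ξ
    _ = (jb ξ)⁻¹ ^ n * d.C := by rw [pow_succ]; field_simp
    _ ≤ 1 * d.C := by gcongr; exact d.C_nonneg
    _ = d.C := one_mul _

theorem isBddSymbol_jbInv_mul_p (n : ℕ) :
    IsBddSymbol fun ξ => jbInv (n + 1) ξ * (Complex.I * d.p ξ) := by
  have h1 := measurable_jbInv (n + 1)
  have h2 := d.measurable_p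
  refine ⟨by fun_prop, d.C, fun ξ => ?_⟩
  change ‖jbInv (n + 1) ξ * (Complex.I * d.p ξ)‖ ≤ d.C
  rw [mul_left_comm, norm_mul, Complex.norm_I, one_mul]
  exact d.norm_jbInv_mul_p_le n ξ

theorem norm_grp (t : ℝ) (x : L2C) : ‖d.grp t x‖ = ‖x‖ := by
  refine norm_mulOp_apply_eq (isBddSymbol_exp isBddSymbol_one d.measurable_p t).1 (fun ξ => ?_) x
  rw [one_mul, norm_exp_I_mul_real]

theorem continuous_grp : Continuous fun q : ℝ × L2C => d.grp q.1 q.2 :=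
  continuous_uncurry_expOp isBddSymbol_one d.measurable_p

theorem grp_zero (x : L2C) : d.grp 0 x = x := by
  rw [grp, expOp_zero, mulOp_one]

theorem expOp_grp {m : ℝ → ℂ} (hm : IsBddSymbol m) (s t : ℝ) (x : L2C) :
    expOp m d.p s (d.grp t x) = expOp m d.p (s + t) x := by
  rw [grp, expOp_expOp hm isBddSymbol_one d.measurable_p]
  simp only [mul_one]

theorem grp_grp_neg (t : ℝ) (x : L2C) : d.grp t (d.grp (-t) x) = x := by
  conv_lhs => rw [grp]
  rw [d.expOp_grp isBddSymbol_one, add_neg_cancel]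
  exact d.grp_zero x

theorem continuous_quad : Continuous d.quad :=
  (kernelOp d.isKernel).continuous.clm_apply continuous_id

theorem norm_quad_le (x : L2C) : ‖d.quad x‖ ≤ d.M * ‖x‖ * ‖x‖ :=
  norm_kernelOp_apply_le d.isKernel x x

theorem norm_quad_sub_le (x y : L2C) :
    ‖d.quad x - d.quad y‖ ≤ d.M * (‖x‖ + ‖y‖) * ‖x - y‖ := by
  have e : d.quad x - d.quad y = kernelOp d.isKernel x (x - y) + kernelOp d.isKernel (x - y) y := by
    simp only [quad, map_sub, sub_apply]
    abel
  rw [e]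
  refine (norm_add_le _ _).trans ((add_le_add (norm_kernelOp_apply_le _ _ _)
    (norm_kernelOp_apply_le _ _ _)).trans (le_of_eq ?_))
  ring

/-- The group preserves norms, so the bounds for the quadratic term pass to the field unchanged and
uniformly in time. Only strong continuity of the group is used. -/
theorem isLocLipField : IsLocLipField d.field where
  continuous := by
    have h1 := d.continuous_quad.comp d.continuous_grp
    have h2 := (continuous_fst (X := ℝ) (Y := L2C)).neg.prodMk h1
    have h3 := d.continuous_grp.comp h2
    exact h3
  lipschitz := by
    intro R
    have hM := d.isKernel.2.1
    refine ⟨Real.toNNReal (d.M * (R + R)), fun t => LipschitzOnWith.of_dist_le_mul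
      fun x hx y hy => ?_⟩
    rw [mem_closedBall_zero_iff] at hx hy
    have hR : 0 ≤ R := (norm_nonneg _).trans hx
    rw [dist_eq_norm, dist_eq_norm, field, field, ← map_sub, norm_grp,
      Real.coe_toNNReal _ (by positivity)]
    refine (d.norm_quad_sub_le _ _).trans ?_
    rw [← map_sub, norm_grp, norm_grp, norm_grp]
    gcongr
  bounded := by
    intro R
    have hM := d.isKernel.2.1
    refine ⟨Real.toNNReal (d.M * R * R), fun t x hx => ?_⟩
    rw [mem_closedBall_zero_iff] at hx
    have hR : 0 ≤ R := (norm_nonneg _).trans hx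
    rw [field, norm_grp, Real.coe_toNNReal _ (by positivity)]
    refine (d.norm_quad_le _).trans ?_
    rw [norm_grp]
    gcongr

end SemilinearData

namespace SemilinearData

variable (d : SemilinearData)

theorem continuous_vel : Continuous d.vel := by
  have h1 := d.continuous_quad
  have h2 := (mulOp (jbInv 3)).continuous.comp h1
  exact (mulOp _).continuous.add h2

/-- A solution in the interaction picture gives a solution of the original equation. -/
theorem jbInv_grp_eq_integral {T : ℝ} {U : ℝ → L2C}
    (hU : ∀ t ∈ Set.Icc 0 T, HasDerivWithinAt U (d.field t (U t)) (Set.Icc 0 T) t) {t : ℝ}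
    (ht : t ∈ Set.Icc 0 T) :
    mulOp (jbInv 3) (d.grp t (U t)) =
      mulOp (jbInv 3) (U 0) + ∫ s in (0 : ℝ)..t, d.vel (d.grp s (U s)) := by
  have hp := d.measurable_p
  have hb := isBddSymbol_jbInv 3
  have hb' := d.isBddSymbol_jbInv_mul_p 2
  have hC : ∀ ξ, ‖jbInv 3 ξ‖ ≤ max 1 d.C := fun ξ => (norm_jbInv_le_one 3 ξ).trans (le_max_left _ _)
  have hC' : ∀ ξ, ‖jbInv 3 ξ * (Complex.I * d.p ξ)‖ ≤ max 1 d.C := fun ξ => by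
    rw [mul_left_comm, norm_mul, Complex.norm_I, one_mul]
    exact (d.norm_jbInv_mul_p_le 2 ξ).trans (le_max_right _ _)
  have hUc : ContinuousOn U (Set.Icc 0 t) := fun s hs =>
    (hU s ⟨hs.1, hs.2.trans ht.2⟩).continuousWithinAt.mono (Set.Icc_subset_Icc_right ht.2)
  have hFi : IntegrableOn (fun s => d.field s (U s)) (Set.Ioc 0 t) :=
    ((d.isLocLipField.continuous.comp_continuousOn
      (continuousOn_id.prodMk hUc)).integrableOn_Icc).mono_set Set.Ioc_subset_Icc_self
  -- The weight `⟨ξ⟩⁻³` makes `exp(itp)` strongly differentiable with bounded derivative, and it is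
  -- also the weight that turns `Φ` into the transform of `f`.
  have key := apply_integral_eq (continuous_uncurry_expOp hb hp) (continuous_uncurry_expOp hb' hp)
    (norm_expOp_apply_le hb.1 hC hp) (norm_expOp_apply_le hb'.1 hC' hp)
    (fun t x => hasDerivAt_expOp hb hp (d.norm_jbInv_mul_p_le 2) x t) (U 0) ht.1 hFi
  rw [← d.isLocLipField.eq_integral hU ht] at key
  have e1 : mulOp (jbInv 3) (d.grp t (U t)) = expOp (jbInv 3) d.p t (U t) := by
    rw [mulOp_eq_expOp _ d.p, d.expOp_grp hb, zero_add]
  rw [e1, key, expOp_zero]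
  congr 1
  refine intervalIntegral.integral_congr fun s hs => ?_
  rw [Set.uIcc_of_le ht.1] at hs
  rw [← d.isLocLipField.eq_integral hU ⟨hs.1, hs.2.trans ht.2⟩, field, d.expOp_grp hb,
    add_neg_cancel, expOp_zero, vel, mulOp_eq_expOp (fun ξ => jbInv 3 ξ * (Complex.I * d.p ξ)) d.p,
    d.expOp_grp hb', zero_add, add_comm]

theorem field_grp_neg (s : ℝ) (x : L2C) : d.field s (d.grp (-s) x) = d.grp (-s) (d.quad x) := by
  rw [field, grp_grp_neg]

theorem integrable_field {T : ℝ} {G : ℝ → L2C} (hG : MemLp G ∞ (timeMeasure T)) :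
    Integrable (fun s => d.field s (d.grp (-s) (G s))) (timeMeasure T) := by
  simp only [field_grp_neg]
  have hm : AEStronglyMeasurable (fun s => d.grp (-s) (d.quad (G s))) (timeMeasure T) := by
    have h1 := d.continuous_quad.comp_aestronglyMeasurable hG.1
    have h2 : AEStronglyMeasurable (fun s : ℝ => -s) (timeMeasure T) :=
      measurable_neg.aestronglyMeasurable
    have h3 := d.continuous_grp.comp_aestronglyMeasurable (h2.prodMk h1)
    exact h3
  set R := (eLpNormEssSup G (timeMeasure T)).toReal with hR
  have hlt : eLpNormEssSup G (timeMeasure T) < ∞ := by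
    have := hG.2
    rwa [eLpNorm_exponent_top] at this
  have hq : MemLp (fun s => d.grp (-s) (d.quad (G s))) ∞ (timeMeasure T) := by
    refine memLp_top_of_bound hm (d.M * R * R) ?_
    filter_upwards [ae_le_eLpNormEssSup (f := G) (μ := timeMeasure T)] with s hs
    have hs' : ‖G s‖ ≤ R := by
      rw [← toReal_enorm]
      exact ENNReal.toReal_mono hlt.ne hs
    rw [norm_grp]
    have := d.isKernel.2.1
    exact (d.norm_quad_le _).trans (by gcongr)
  have : IsFiniteMeasure (timeMeasure T) := inferInstance
  exact hq.integrable le_top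

/-- Every solution of the original equation comes from a solution in the interaction picture. -/
theorem grp_neg_eq_integral {T : ℝ} {U₀ : L2C} {G a : ℝ → L2C} (hG : MemLp G ∞ (timeMeasure T))
    (ha : Integrable a (timeMeasure T)) (hav : ∀ᵐ s ∂timeMeasure T, a s = d.vel (G s))
    (hGa : ∀ᵐ t ∂timeMeasure T,
      mulOp (jbInv 3) (G t) = mulOp (jbInv 3) U₀ + ∫ s in (0 : ℝ)..t, a s) :
    Integrable (fun s => d.field s (d.grp (-s) (G s))) (timeMeasure T) ∧
    ∀ᵐ t ∂timeMeasure T,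
      d.grp (-t) (G t) = U₀ + ∫ s in (0 : ℝ)..t, d.field s (d.grp (-s) (G s)) := by
  have hp := d.measurable_p
  have hp' : Measurable fun ξ => -d.p ξ := hp.neg
  -- The given equation already carries the weight `⟨ξ⟩⁻³`. Differentiating `exp(-itp)` costs one
  -- more power, so the identity is proved with weight `⟨ξ⟩⁻⁴` and the weight is removed at the end
  -- by injectivity.
  have hb := isBddSymbol_jbInv 1
  have hb3 := isBddSymbol_jbInv 3
  have hi := d.integrable_field hG
  refine ⟨hi, ?_⟩
  have hb' : IsBddSymbol fun ξ => jbInv 1 ξ * (Complex.I * ((-d.p ξ : ℝ) : ℂ)) := by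
    have h := d.isBddSymbol_jbInv_mul_p 0
    have h2 := h.mul (n := fun _ => -1) ⟨measurable_const, 1, by simp⟩
    have h3 : (fun ξ => jbInv 1 ξ * (Complex.I * ((-d.p ξ : ℝ) : ℂ))) =
      fun ξ => jbInv (0 + 1) ξ * (Complex.I * (d.p ξ : ℂ)) * -1 := by
      funext ξ
      push_cast
      ring
    rw [h3]
    exact h2
  have hmp : ∀ ξ, ‖jbInv 1 ξ * ((-d.p ξ : ℝ) : ℂ)‖ ≤ d.C := fun ξ => by
    rw [Complex.ofReal_neg, mul_neg, norm_neg]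
    exact d.norm_jbInv_mul_p_le 0 ξ
  have hC : ∀ ξ, ‖jbInv 1 ξ‖ ≤ max 1 d.C := fun ξ => (norm_jbInv_le_one 1 ξ).trans (le_max_left _ _)
  have hC' : ∀ ξ, ‖jbInv 1 ξ * (Complex.I * ((-d.p ξ : ℝ) : ℂ))‖ ≤ max 1 d.C := fun ξ => by
    rw [mul_left_comm, norm_mul, Complex.norm_I, one_mul]
    exact (hmp ξ).trans (le_max_right _ _)
  have hneg : ∀ (m : ℝ → ℂ) (t : ℝ), expOp m (fun ξ => -d.p ξ) t = expOp m d.p (-t) := by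
    intro m t
    simp only [expOp]
    congr 1
    funext ξ
    rw [mul_neg, neg_mul]
  have key := fun (t : ℝ) (ht : t ∈ Set.Ioo 0 T) =>
    apply_integral_eq (continuous_uncurry_expOp hb hp') (continuous_uncurry_expOp hb' hp')
    (norm_expOp_apply_le hb.1 hC hp') (norm_expOp_apply_le hb'.1 hC' hp')
    (fun t x => hasDerivAt_expOp hb hp' hmp x t) (a := a) (mulOp (jbInv 3) U₀) ht.1.le
    (ha.mono_measure (Measure.restrict_mono
      (Set.Ioc_subset_Ioo_right ht.2) le_rfl))
  have h13 : (fun ξ => jbInv 1 ξ * jbInv 3 ξ) = jbInv 4 := by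
    funext ξ
    simp only [jbInv]
    ring
  have hcomb : ∀ (t : ℝ) (x : L2C), expOp (jbInv 1) (fun ξ => -d.p ξ) t (mulOp (jbInv 3) x) =
      mulOp (jbInv 4) (d.grp (-t) x) := by
    intro t x
    rw [hneg, mulOp_eq_expOp _ d.p, expOp_expOp hb hb3 hp, h13, add_zero,
      mulOp_eq_expOp _ d.p, d.expOp_grp (isBddSymbol_jbInv 4), zero_add]
  filter_upwards [hGa, ae_restrict_mem measurableSet_Ioo] with t h1 ht
  have k := key t ht
  rw [← h1, hcomb, hcomb, neg_zero, grp_zero] at k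
  have hsub : Set.Ioo 0 t ⊆ Set.Ioo 0 T := Set.Ioo_subset_Ioo_right ht.2.le
  have k2 : ∫ s in (0 : ℝ)..t, (expOp (jbInv 1) (fun ξ => -d.p ξ) s (a s) +
      expOp (fun ξ => jbInv 1 ξ * (Complex.I * ((-d.p ξ : ℝ) : ℂ))) (fun ξ => -d.p ξ) s
        (mulOp (jbInv 3) U₀ + ∫ r in (0 : ℝ)..s, a r)) =
      ∫ s in (0 : ℝ)..t, mulOp (jbInv 4) (d.field s (d.grp (-s) (G s))) := by
    rw [intervalIntegral.integral_of_le ht.1.le, intervalIntegral.integral_of_le ht.1.le,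
      integral_Ioc_eq_integral_Ioo, integral_Ioc_eq_integral_Ioo]
    apply integral_congr_ae
    filter_upwards [ae_restrict_of_ae_restrict_of_subset hsub hGa,
      ae_restrict_of_ae_restrict_of_subset hsub hav] with s e1 e2
    rw [← e1, e2, vel, map_add, hcomb, field_grp_neg, hneg, hneg, mulOp_eq_expOp (jbInv 3) d.p,
      mulOp_eq_expOp _ d.p, expOp_expOp hb (d.isBddSymbol_jbInv_mul_p 2) hp,
      expOp_expOp hb' hb3 hp, add_right_comm]
    -- The linear term of the equation cancels against the derivative of the group, so only the
    -- quadratic term survives.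
    have e3 : expOp (fun ξ => jbInv 1 ξ * (jbInv (2 + 1) ξ * (Complex.I * d.p ξ))) d.p (-s + 0)
        (G s) + expOp (fun ξ => jbInv 1 ξ * (Complex.I * ((-d.p ξ : ℝ) : ℂ)) * jbInv 3 ξ) d.p
        (-s + 0) (G s) = 0 := by
      have e4 : (fun ξ => jbInv 1 ξ * (Complex.I * ((-d.p ξ : ℝ) : ℂ)) * jbInv 3 ξ) =
          fun ξ => -1 * (jbInv 1 ξ * (jbInv (2 + 1) ξ * (Complex.I * d.p ξ))) := by
        funext ξ
        push_cast
        ring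
      have hm1 : IsBddSymbol fun _ => (-1 : ℂ) := ⟨measurable_const, 1, by simp⟩
      rw [e4, ← zero_add (-s + 0), ← expOp_expOp hm1 (hb.mul (d.isBddSymbol_jbInv_mul_p 2)) hp,
        expOp_zero, zero_add]
      generalize expOp (fun ξ => jbInv 1 ξ * (jbInv (2 + 1) ξ * (Complex.I * d.p ξ))) d.p (-s + 0)
        (G s) = y
      apply Lp.ext
      filter_upwards [Lp.coeFn_add y (mulOp (fun _ => (-1 : ℂ)) y), coeFn_mulOp hm1 y,
        Lp.coeFn_zero ℂ 2 (volume : Measure ℝ)] with ξ h1 h2 h3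
      rw [h1, Pi.add_apply, h2, h3, Pi.zero_apply, neg_one_mul, add_neg_cancel]
    rw [e3, zero_add]
  rw [k2, ContinuousLinearMap.intervalIntegral_comp_comm] at k
  · rw [← map_add] at k
    exact mulOp_injective (isBddSymbol_jbInv 4) (jbInv_ne_zero 4) k
  · exact (intervalIntegrable_iff_integrableOn_Ioo_of_le ht.1.le).2
      (hi.mono_measure (Measure.restrict_mono hsub le_rfl))

end SemilinearData

/-! ### The symbols of the wave equation and their bounds. -/

@[fun_prop]
theorem measurable_real_sign : Measurable Real.sign := by
  unfold Real.sign
  exact Measurable.ite measurableSet_Iio measurable_const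
    (Measurable.ite measurableSet_Ioi measurable_const measurable_const)

theorem abs_real_sign_le (x : ℝ) : |Real.sign x| ≤ 1 := by
  obtain h | h | h := Real.sign_apply_eq x <;> simp [h]

/-- Zero separates `k` and `l`, or is one of them. This is the smoothing effect of `[H, f]`:
wherever its symbol is nonzero, the output frequency `k` is controlled by the frequency `k - l` of
`f`. -/
theorem abs_le_abs_sub_of_sign_ne {k l : ℝ} (h : Real.sign k ≠ Real.sign l) :
    |k| ≤ |k - l| := by
  obtain hk | rfl | hk := lt_trichotomy k 0
  · have hl : 0 ≤ l := by
      by_contra hl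
      exact h (by rw [Real.sign_of_neg hk, Real.sign_of_neg (not_le.1 hl)])
    rw [abs_of_neg hk, abs_of_nonpos (by linarith)]
    linarith
  · simp
  · have hl : l ≤ 0 := by
      by_contra hl
      exact h (by rw [Real.sign_of_pos hk, Real.sign_of_pos (not_le.1 hl)])
    rw [abs_of_pos hk, abs_of_nonneg (by linarith)]
    linarith

theorem jb_le_jb {x y : ℝ} (h : |x| ≤ |y|) : jb x ≤ jb y := by
  unfold jb
  gcongr 1
  linarith [sq_le_sq.2 h]

theorem jb_sq_le (ξ η : ℝ) : jb ξ ^ 2 ≤ 2 * (jb (ξ - η) ^ 2 + jb η ^ 2) := by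
  rw [jb_sq, jb_sq, jb_sq]
  -- Up to a constant, the right side minus the left side is exactly this square.
  nlinarith [sq_nonneg (ξ - 2 * η)]

theorem jb_le_one_add_abs (ξ : ℝ) : jb ξ ≤ 1 + |ξ| := by
  rw [jb, Real.sqrt_le_left (by positivity)]
  nlinarith [sq_abs ξ, abs_nonneg ξ]

/-- The operator `2 + α Λ` has order one. -/
theorem jb_le_mul_two_add {α : ℝ} (hα : 0 < α) (ξ : ℝ) :
    jb ξ ≤ (1 + α⁻¹) * (2 + α * |2 * Real.pi * ξ|) := by
  refine (jb_le_one_add_abs ξ).trans ?_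
  rw [abs_mul, abs_of_pos Real.two_pi_pos]
  have h1 := abs_nonneg ξ
  have h2 := Real.pi_gt_three
  have h3 : (1 + α⁻¹) * (2 + α * (2 * Real.pi * |ξ|)) =
      2 + 2 * α⁻¹ + α * (2 * Real.pi * |ξ|) + 2 * Real.pi * |ξ| := by
    field_simp
    ring
  rw [h3]
  have h4 : 0 < α⁻¹ := inv_pos.2 hα
  have h5 : 0 ≤ α * (2 * Real.pi * |ξ|) := by positivity
  nlinarith

/-- The dispersion symbol of the linear part. -/
def dispersion (α β ε ξ : ℝ) : ℝ :=
  ε⁻¹ * (2 * Real.pi * ξ - Real.sign (2 * Real.pi * ξ) +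
    (α - β) * (Real.sign (2 * Real.pi * ξ) * (2 * Real.pi * ξ) ^ 2)) /
    (2 + α * |2 * Real.pi * ξ|)

/-- The (real) symbol of the quadratic terms at the frequencies `k` and `l`. -/
def quadSymbol (γ k l : ℝ) : ℝ :=
  Real.sign k * (|k - l| * |l|) + (Real.sign k - Real.sign l) * (γ * |l| ^ 3 - |l|)

/-- The kernel of the quadratic terms in weighted variables. -/
def quadKernel (α β ξ η : ℝ) : ℂ :=
  -Complex.I * ((jb ξ ^ 3 / (2 + α * |2 * Real.pi * ξ|) *
    quadSymbol (α - β) (2 * Real.pi * ξ) (2 * Real.pi * η) *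
    ((jb (ξ - η))⁻¹ ^ 3 * (jb η)⁻¹ ^ 3) : ℝ) : ℂ)

theorem abs_dispersion_le {α : ℝ} (hα : 0 < α) (β : ℝ) {ε : ℝ} (hε : 0 < ε) (ξ : ℝ) :
    |dispersion α β ε ξ| ≤
      ε⁻¹ * (1 + α⁻¹) * (2 * Real.pi + 1 + |α - β| * (2 * Real.pi) ^ 2) * jb ξ := by
  have hd : 0 < 2 + α * |2 * Real.pi * ξ| := by positivity
  have hj := jb_le_mul_two_add hα ξ
  have h0 := jb_pos ξ
  have h1 := one_le_jb ξ
  have hk : |2 * Real.pi * ξ| ≤ 2 * Real.pi * jb ξ := by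
    rw [abs_mul, abs_of_pos Real.two_pi_pos]
    gcongr
    exact abs_le_jb ξ
  have hα' : 0 < α⁻¹ := inv_pos.2 hα
  have hpi := Real.pi_pos
  have hs := abs_real_sign_le (2 * Real.pi * ξ)
  have hnum : |2 * Real.pi * ξ - Real.sign (2 * Real.pi * ξ) +
      (α - β) * (Real.sign (2 * Real.pi * ξ) * (2 * Real.pi * ξ) ^ 2)| ≤
      (2 * Real.pi + 1 + |α - β| * (2 * Real.pi) ^ 2) * jb ξ ^ 2 := by
    have e3 : |(α - β) * (Real.sign (2 * Real.pi * ξ) * (2 * Real.pi * ξ) ^ 2)| ≤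
        |α - β| * (1 * (2 * Real.pi * jb ξ) ^ 2) := by
      rw [abs_mul, abs_mul, abs_pow]
      gcongr
    calc _ ≤ |2 * Real.pi * ξ| + |Real.sign (2 * Real.pi * ξ)| +
          |(α - β) * (Real.sign (2 * Real.pi * ξ) * (2 * Real.pi * ξ) ^ 2)| :=
          (abs_add_le _ _).trans (by gcongr; exact abs_sub _ _)
      _ ≤ 2 * Real.pi * jb ξ + 1 + |α - β| * (1 * (2 * Real.pi * jb ξ) ^ 2) := by gcongr
      _ ≤ _ := by nlinarith [mul_nonneg hpi.le (mul_nonneg h0.le (sub_nonneg.2 h1))]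
  rw [dispersion, abs_div, abs_mul, abs_of_pos hd, abs_of_pos (inv_pos.2 hε), div_le_iff₀ hd]
  calc _ ≤ ε⁻¹ * ((2 * Real.pi + 1 + |α - β| * (2 * Real.pi) ^ 2) * jb ξ ^ 2) := by gcongr
    _ = ε⁻¹ * (2 * Real.pi + 1 + |α - β| * (2 * Real.pi) ^ 2) * jb ξ * jb ξ := by ring
    _ ≤ ε⁻¹ * (2 * Real.pi + 1 + |α - β| * (2 * Real.pi) ^ 2) * jb ξ *
        ((1 + α⁻¹) * (2 + α * |2 * Real.pi * ξ|)) := by gcongr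
    _ = _ := by ring

/-- The smoothing property of the commutator makes the kernel bounded. -/
theorem norm_quadKernel_le {α : ℝ} (hα : 0 < α) (β ξ η : ℝ) :
    ‖quadKernel α β ξ η‖ ≤ (1 + α⁻¹) * (2 * (2 * Real.pi) ^ 2 +
      2 * (|α - β| * (2 * Real.pi) ^ 3 + 2 * Real.pi)) * ((jb (ξ - η))⁻¹ + (jb η)⁻¹) := by
  have hα' : 0 < α⁻¹ := inv_pos.2 hα
  have hpi := Real.two_pi_pos
  have hd : 0 < 2 + α * |2 * Real.pi * ξ| := by positivity
  set c := 2 * Real.pi with hc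
  set γ := α - β
  set z := jb ξ with hz
  set x := jb (ξ - η) with hx
  set y := jb η with hy
  have z0 : 0 < z := jb_pos _
  have x0 : 0 < x := jb_pos _
  have y0 : 0 < y := jb_pos _
  have x1 : 1 ≤ x := one_le_jb _
  have y1 : 1 ≤ y := one_le_jb _
  have hl : |c * η| ≤ c * y := by
    rw [abs_mul, abs_of_pos hpi]; gcongr; exact abs_le_jb η
  have hkl : |c * ξ - c * η| ≤ c * x := by
    rw [← mul_sub, abs_mul, abs_of_pos hpi]; gcongr; exact abs_le_jb _
  -- Inverting `2 + αΛ` gains one derivative, leaving two output powers to be distributed.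
  have hquot : z ^ 3 / (2 + α * |c * ξ|) ≤ (1 + α⁻¹) * z ^ 2 := by
    rw [div_le_iff₀ hd]
    calc z ^ 3 = z ^ 2 * z := by ring
      _ ≤ z ^ 2 * ((1 + α⁻¹) * (2 + α * |c * ξ|)) := by gcongr; exact jb_le_mul_two_add hα ξ
      _ = _ := by ring
  -- The term `H((Λf)²)`: with `z² ≤ 2(x² + y²)`, whichever factor receives the two powers, the
  -- other keeps the decay `⟨·⟩⁻²`.
  have hsym1 : z ^ 2 * |Real.sign (c * ξ) * (|c * ξ - c * η| * |c * η|)| * (x⁻¹ ^ 3 * y⁻¹ ^ 3) ≤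
      2 * c ^ 2 * (x⁻¹ + y⁻¹) := by
    have h1 : |Real.sign (c * ξ) * (|c * ξ - c * η| * |c * η|)| ≤ 1 * ((c * x) * (c * y)) := by
      rw [abs_mul, abs_mul, abs_abs, abs_abs]
      gcongr
      exact abs_real_sign_le _
    calc _ ≤ 2 * (x ^ 2 + y ^ 2) * (1 * ((c * x) * (c * y))) * (x⁻¹ ^ 3 * y⁻¹ ^ 3) := by
          gcongr
          exact jb_sq_le ξ η
      _ = 2 * c ^ 2 * (x⁻¹ * x⁻¹ + y⁻¹ * y⁻¹) := by field_simp; ring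
      _ ≤ 2 * c ^ 2 * (x⁻¹ * 1 + y⁻¹ * 1) := by
          gcongr
          · exact inv_le_one_of_one_le₀ x1
          · exact inv_le_one_of_one_le₀ y1
      _ = _ := by ring
  -- The commutator terms: either the symbol vanishes or `z ≤ x`. In the latter case `y⁻³` absorbs
  -- all derivatives on the second factor, and `z² x⁻³ ≤ x⁻¹` is left.
  have hsym2 : z ^ 2 * |(Real.sign (c * ξ) - Real.sign (c * η)) * (γ * |c * η| ^ 3 - |c * η|)| *
      (x⁻¹ ^ 3 * y⁻¹ ^ 3) ≤ 2 * (|γ| * c ^ 3 + c) * (x⁻¹ + y⁻¹) := by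
    by_cases hs : Real.sign (c * ξ) = Real.sign (c * η)
    · rw [hs, sub_self, zero_mul, abs_zero]
      simp only [mul_zero, zero_mul]
      positivity
    · have hzx : z ≤ x := by
        apply jb_le_jb
        have h1 := abs_le_abs_sub_of_sign_ne hs
        rw [← mul_sub, abs_mul c ξ, abs_mul c (ξ - η)] at h1
        exact le_of_mul_le_mul_left h1 (abs_pos.2 hpi.ne')
      have h1 : |(Real.sign (c * ξ) - Real.sign (c * η)) * (γ * |c * η| ^ 3 - |c * η|)| ≤
          (1 + 1) * (|γ| * (c * y) ^ 3 + c * y) := by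
        rw [abs_mul]
        gcongr
        · exact (abs_sub _ _).trans (add_le_add (abs_real_sign_le _) (abs_real_sign_le _))
        · refine (abs_sub _ _).trans ?_
          rw [abs_mul, abs_pow, abs_abs]
          gcongr
      have h2 : c * y ≤ c * y ^ 3 := by
        gcongr
        exact le_self_pow₀ y1 (by norm_num)
      calc _ ≤ x ^ 2 * ((1 + 1) * (|γ| * (c * y) ^ 3 + c * y ^ 3)) * (x⁻¹ ^ 3 * y⁻¹ ^ 3) := by
            gcongr
            exact h1.trans (by gcongr)
        _ = 2 * (|γ| * c ^ 3 + c) * x⁻¹ := by field_simp; ring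
        _ ≤ _ := by
            have := inv_pos.2 y0
            gcongr
            linarith
  rw [quadKernel, norm_mul, norm_neg, Complex.norm_I, one_mul, Complex.norm_real,
    Real.norm_eq_abs, abs_mul, abs_mul, abs_of_nonneg (by positivity : 0 ≤ z ^ 3 / (2 + α * |c * ξ|)),
    abs_of_nonneg (by positivity : 0 ≤ x⁻¹ ^ 3 * y⁻¹ ^ 3), quadSymbol]
  calc _ ≤ (1 + α⁻¹) * z ^ 2 * (|Real.sign (c * ξ) * (|c * ξ - c * η| * |c * η|)| +
        |(Real.sign (c * ξ) - Real.sign (c * η)) * (γ * |c * η| ^ 3 - |c * η|)|) *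
        (x⁻¹ ^ 3 * y⁻¹ ^ 3) := by
        gcongr
        exact abs_add_le _ _
    _ = (1 + α⁻¹) * (z ^ 2 * |Real.sign (c * ξ) * (|c * ξ - c * η| * |c * η|)| *
          (x⁻¹ ^ 3 * y⁻¹ ^ 3) + z ^ 2 *
          |(Real.sign (c * ξ) - Real.sign (c * η)) * (γ * |c * η| ^ 3 - |c * η|)| *
          (x⁻¹ ^ 3 * y⁻¹ ^ 3)) := by ring
    _ ≤ (1 + α⁻¹) * (2 * c ^ 2 * (x⁻¹ + y⁻¹) + 2 * (|γ| * c ^ 3 + c) * (x⁻¹ + y⁻¹)) := by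
        gcongr
    _ = _ := by ring

theorem measurable_quadKernel (α β : ℝ) : Measurable (Function.uncurry (quadKernel α β)) := by
  have := measurable_jb
  simp only [Function.uncurry_def, quadKernel, quadSymbol]
  fun_prop

/-- The equation as a semilinear equation on the Fourier side. -/
def waveData {α : ℝ} (hα : 0 < α) (β : ℝ) {ε : ℝ} (hε : 0 < ε) : SemilinearData where
  p := dispersion α β ε
  b := quadKernel α β
  C := _
  M := _
  measurable_p := by
    unfold dispersion
    fun_prop
  norm_p_le := abs_dispersion_le hα β hε
  isKernel := isKernel_of_le (by have := inv_pos.2 hα; positivity) (measurable_quadKernel α β)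
    (norm_quadKernel_le hα β)

/-! ### The equation in Fourier variables. -/

theorem fourier_multiplier_ae_eq {m : ℝ → ℂ} {f : L2C}
    (h : MemLp (fun ξ : ℝ => m (2 * Real.pi * ξ) * (𝓕 f : L2C) ξ) 2 volume) :
    (𝓕 (multiplier m f) : L2C) =ᵐ[volume] fun ξ => m (2 * Real.pi * ξ) * (𝓕 f : L2C) ξ := by
  rw [multiplier, dif_pos h, FourierTransform.fourier_fourierInv_eq]
  exact h.coeFn_toLp

/-- Multipliers of order at most three on functions given by their weighted Fourier transform. -/
theorem fourier_multiplier_of_weighted {m n : ℝ → ℂ} {f Φ : L2C}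
    (hf : (𝓕 f : L2C) =ᵐ[volume] fun ξ => n ξ * Φ ξ)
    (hm : IsBddSymbol fun ξ => m (2 * Real.pi * ξ) * n ξ) :
    (𝓕 (multiplier m f) : L2C) =ᵐ[volume] fun ξ => m (2 * Real.pi * ξ) * n ξ * Φ ξ := by
  have h1 : (fun ξ : ℝ => m (2 * Real.pi * ξ) * (𝓕 f : L2C) ξ) =ᵐ[volume]
      fun ξ => m (2 * Real.pi * ξ) * n ξ * Φ ξ := by
    filter_upwards [hf] with ξ h
    rw [h]
    ring
  have h2 : MemLp (fun ξ : ℝ => m (2 * Real.pi * ξ) * (𝓕 f : L2C) ξ) 2 volume :=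
    (memLp_congr_ae (h1.trans (coeFn_mulOp hm Φ).symm)).2 (Lp.memLp _)
  exact (fourier_multiplier_ae_eq h2).trans h1

theorem isBddSymbol_pow_mul_jbInv {u : ℝ → ℂ} (hu : Measurable u) {C : ℝ} {j n : ℕ}
    (h : ∀ ξ, ‖u ξ‖ ≤ C * jb ξ ^ j) (hjn : j ≤ n) : IsBddSymbol fun ξ => u ξ * jbInv n ξ := by
  refine ⟨hu.mul (measurable_jbInv n), C, fun ξ => ?_⟩
  have h0 := jb_pos ξ
  have hC : 0 ≤ C :=
    nonneg_of_mul_nonneg_left ((norm_nonneg _).trans (h ξ)) (pow_pos h0 j)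
  rw [norm_mul, norm_jbInv]
  calc ‖u ξ‖ * (jb ξ)⁻¹ ^ n ≤ C * jb ξ ^ j * (jb ξ)⁻¹ ^ n := by gcongr; exact h ξ
    _ = C * (jb ξ)⁻¹ ^ (n - j) := by
        obtain ⟨i, rfl⟩ := Nat.exists_eq_add_of_le hjn
        rw [Nat.add_sub_cancel_left, pow_add, inv_pow, inv_pow]
        field_simp
    _ ≤ C * 1 := by
        gcongr
        exact pow_le_one₀ (inv_pos.2 h0).le (inv_le_one_of_one_le₀ (one_le_jb ξ))
    _ = C := mul_one C

theorem abs_two_pi_mul_pow_le (j : ℕ) (ξ : ℝ) :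
    |2 * Real.pi * ξ| ^ j ≤ (2 * Real.pi) ^ j * jb ξ ^ j := by
  rw [abs_mul, abs_of_pos Real.two_pi_pos, mul_pow]
  have := Real.two_pi_pos
  gcongr
  exact abs_le_jb ξ

theorem isBddSymbol_lambda {j n : ℕ} (hjn : j ≤ n) :
    IsBddSymbol fun ξ => ((|2 * Real.pi * ξ| ^ j : ℝ) : ℂ) * jbInv n ξ := by
  refine isBddSymbol_pow_mul_jbInv (C := (2 * Real.pi) ^ j) (by fun_prop) (fun ξ => ?_) hjn
  rw [Complex.norm_real, Real.norm_eq_abs, abs_of_nonneg (by positivity)]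
  exact abs_two_pi_mul_pow_le j ξ

theorem isBddSymbol_dx {j n : ℕ} (hjn : j ≤ n) :
    IsBddSymbol fun ξ => (Complex.I * ((2 * Real.pi * ξ : ℝ) : ℂ)) ^ j * jbInv n ξ := by
  refine isBddSymbol_pow_mul_jbInv (C := (2 * Real.pi) ^ j) (by fun_prop) (fun ξ => ?_) hjn
  rw [norm_pow, norm_mul, Complex.norm_I, one_mul, Complex.norm_real, Real.norm_eq_abs]
  exact abs_two_pi_mul_pow_le j ξ

/-- The symbol of the Hilbert transform at the frequency `2πξ`. -/
def hilbertSymbol (ξ : ℝ) : ℂ := -Complex.I * (Real.sign (2 * Real.pi * ξ) : ℂ)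

theorem isBddSymbol_hilbert : IsBddSymbol hilbertSymbol := by
  refine ⟨by unfold hilbertSymbol; fun_prop, 1, fun ξ => ?_⟩
  rw [hilbertSymbol, norm_mul, norm_neg, Complex.norm_I, one_mul, Complex.norm_real]
  exact abs_real_sign_le _

theorem fourier_hilbert (g : L2C) :
    (𝓕 (hilbert g) : L2C) =ᵐ[volume] fun ξ => hilbertSymbol ξ * (𝓕 g : L2C) ξ := by
  refine fourier_multiplier_ae_eq (m := fun k => -Complex.I * (Real.sign k : ℂ)) ?_
  exact (memLp_congr_ae (coeFn_mulOp isBddSymbol_hilbert (𝓕 g))).1 (Lp.memLp _)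

/-- The Fourier transform of the product of two functions given by their weighted Fourier
transforms. -/
theorem fourier_mul_of_weighted {f g Φ : L2C} {m n : ℝ → ℂ} (hm : IsBddSymbol m)
    (hn : IsBddSymbol n) (hf : (𝓕 f : L2C) =ᵐ[volume] fun ξ => jbInv 1 ξ * m ξ * Φ ξ)
    (hg : (𝓕 g : L2C) =ᵐ[volume] fun ξ => n ξ * Φ ξ) :
    ∀ᵐ ξ, Integrable (fun η => jbInv 1 (ξ - η) * m (ξ - η) * n η * (Φ (ξ - η) * Φ η)) ∧
      (𝓕 (mul f g) : L2C) ξ =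
        ∫ η, jbInv 1 (ξ - η) * m (ξ - η) * n η * (Φ (ξ - η) * Φ η) := by
  have hf' : (𝓕 f : L2C) =ᵐ[volume] fun ξ => ((jb ξ : ℂ))⁻¹ * (mulOp m Φ) ξ := by
    filter_upwards [hf, coeFn_mulOp hm Φ] with ξ h1 h2
    rw [h1, h2, jbInv, pow_one, mul_assoc]
  have h1 := ae_integrable_kernel isKernel_jb_inv (mulOp m Φ) (mulOp n Φ)
  filter_upwards [h1, fourier_mul_ae_eq hf' g] with ξ h2 h3
  have e : (fun η => ((jb (ξ - η) : ℂ))⁻¹ * ((mulOp m Φ) (ξ - η) * (mulOp n Φ) η)) =ᵐ[volume]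
      fun η => jbInv 1 (ξ - η) * m (ξ - η) * n η * (Φ (ξ - η) * Φ η) := by
    filter_upwards [ae_sub_left (coeFn_mulOp hm Φ) ξ, coeFn_mulOp hn Φ] with η e1 e2
    rw [e1, e2, jbInv, pow_one]
    ring
  refine ⟨h2.congr e, ?_⟩
  rw [h3, kernelFun_congr hf' (hg.trans (coeFn_mulOp hn Φ).symm), ← integral_congr_ae e]
  simp only [kernelFun, one_mul, mul_assoc]

theorem real_smul_eq (r : ℝ) (g : L2C) : r • g = (r : ℂ) • g := by
  apply Lp.ext
  filter_upwards [Lp.coeFn_smul r g, Lp.coeFn_smul (r : ℂ) g] with x h1 h2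
  rw [h1, h2, Pi.smul_apply, Pi.smul_apply, Complex.real_smul, smul_eq_mul]

theorem coeFn_real_smul (r : ℝ) (g : L2C) : ⇑(r • g) =ᵐ[volume] fun ξ => (r : ℂ) * g ξ := by
  filter_upwards [Lp.coeFn_smul r g] with ξ h
  rw [h, Pi.smul_apply, Complex.real_smul]

theorem coeFn_rhs_combination (r s : ℝ) (a₁ a₂ a₃ a₄ a₅ a₆ a₇ a₈ : L2C) :
    ⇑(r • (a₁ + a₂ + s • a₃) + a₄ - (a₅ - a₆) + s • (a₇ - a₈)) =ᵐ[volume] fun ξ =>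
      (r : ℂ) * (a₁ ξ + a₂ ξ + s * a₃ ξ) + a₄ ξ - (a₅ ξ - a₆ ξ) + s * (a₇ ξ - a₈ ξ) := by
  filter_upwards [Lp.coeFn_add (r • (a₁ + a₂ + s • a₃) + a₄ - (a₅ - a₆)) (s • (a₇ - a₈)),
    Lp.coeFn_sub (r • (a₁ + a₂ + s • a₃) + a₄) (a₅ - a₆),
    Lp.coeFn_add (r • (a₁ + a₂ + s • a₃)) a₄, coeFn_real_smul r (a₁ + a₂ + s • a₃),
    Lp.coeFn_add (a₁ + a₂) (s • a₃), Lp.coeFn_add a₁ a₂, coeFn_real_smul s a₃,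
    Lp.coeFn_sub a₅ a₆, coeFn_real_smul s (a₇ - a₈), Lp.coeFn_sub a₇ a₈]
    with ξ h1 h2 h3 h4 h5 h6 h7 h8 h9 h10
  rw [h1, Pi.add_apply, h2, Pi.sub_apply, h3, Pi.add_apply, h4, h5, Pi.add_apply, h6,
    Pi.add_apply, h7, h8, Pi.sub_apply, h9, h10, Pi.sub_apply]

/-- The Fourier transform of the right-hand side of the equation. -/
theorem fourier_rhs {α : ℝ} (hα : 0 < α) (β : ℝ) {ε : ℝ} (hε : 0 < ε) {f Φ : L2C}
    (hf : (𝓕 f : L2C) =ᵐ[volume] fun ξ => jbInv 3 ξ * Φ ξ) :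
    (𝓕 (rhs α β ε f) : L2C) =ᵐ[volume] fun ξ =>
      ((2 + α * |2 * Real.pi * ξ| : ℝ) : ℂ) * (waveData hα β hε).vel Φ ξ := by
  have hΛ1 : (𝓕 (lambdaPow 1 f) : L2C) =ᵐ[volume] fun ξ =>
      ((|2 * Real.pi * ξ| ^ 1 : ℝ) : ℂ) * jbInv 3 ξ * Φ ξ :=
    fourier_multiplier_of_weighted (m := fun k => ((|k| ^ 1 : ℝ) : ℂ)) hf
      (isBddSymbol_lambda (by norm_num))
  have hΛ3 : (𝓕 (lambdaPow 3 f) : L2C) =ᵐ[volume] fun ξ =>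
      ((|2 * Real.pi * ξ| ^ 3 : ℝ) : ℂ) * jbInv 3 ξ * Φ ξ :=
    fourier_multiplier_of_weighted (m := fun k => ((|k| ^ 3 : ℝ) : ℂ)) hf
      (isBddSymbol_lambda (by norm_num))
  have hd1 : (𝓕 (dx 1 f) : L2C) =ᵐ[volume] fun ξ =>
      (Complex.I * ((2 * Real.pi * ξ : ℝ) : ℂ)) ^ 1 * jbInv 3 ξ * Φ ξ :=
    fourier_multiplier_of_weighted (m := fun k => (Complex.I * (k : ℂ)) ^ 1) hf
      (isBddSymbol_dx (by norm_num))
  have hd2 : (𝓕 (dx 2 f) : L2C) =ᵐ[volume] fun ξ =>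
      (Complex.I * ((2 * Real.pi * ξ : ℝ) : ℂ)) ^ 2 * jbInv 3 ξ * Φ ξ :=
    fourier_multiplier_of_weighted (m := fun k => (Complex.I * (k : ℂ)) ^ 2) hf
      (isBddSymbol_dx (by norm_num))
  have hH : ∀ {g : L2C} {n : ℝ → ℂ}, ((𝓕 g : L2C) =ᵐ[volume] fun ξ => n ξ * Φ ξ) →
      (𝓕 (hilbert g) : L2C) =ᵐ[volume] fun ξ => hilbertSymbol ξ * n ξ * Φ ξ := by
    intro g n hg
    filter_upwards [fourier_hilbert g, hg] with ξ h1 h2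
    rw [h1, h2, mul_assoc]
  have hb1 := isBddSymbol_lambda (j := 1) (n := 3) (by norm_num)
  have hb3 := isBddSymbol_lambda (j := 3) (n := 3) (by norm_num)
  -- The first factor of each product reserves one weight for integrability of its transform; the
  -- two others remain available for derivatives.
  have hf1 : (𝓕 f : L2C) =ᵐ[volume] fun ξ => jbInv 1 ξ * jbInv 2 ξ * Φ ξ := by
    filter_upwards [hf] with ξ h
    rw [h, jbInv, jbInv, jbInv]
    ring
  have hΛ1' : (𝓕 (lambdaPow 1 f) : L2C) =ᵐ[volume] fun ξ =>
      jbInv 1 ξ * (((|2 * Real.pi * ξ| ^ 1 : ℝ) : ℂ) * jbInv 2 ξ) * Φ ξ := by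
    filter_upwards [hΛ1] with ξ h
    rw [h, jbInv, jbInv, jbInv]
    ring
  have P1 := fourier_mul_of_weighted (isBddSymbol_lambda (j := 1) (n := 2) (by norm_num)) hb1
    hΛ1' hΛ1
  have P2 := fourier_mul_of_weighted (isBddSymbol_jbInv 2) hb1 hf1 hΛ1
  have P3 := fourier_mul_of_weighted (isBddSymbol_jbInv 2) (isBddSymbol_hilbert.mul hb1) hf1
    (hH hΛ1)
  have P4 := fourier_mul_of_weighted (isBddSymbol_jbInv 2) hb3 hf1 hΛ3
  have P5 := fourier_mul_of_weighted (isBddSymbol_jbInv 2) (isBddSymbol_hilbert.mul hb3) hf1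
    (hH hΛ3)
  set d := waveData hα β hε with hd
  have hexp : 𝓕 (rhs α β ε f) = ε⁻¹ • (𝓕 (dx 1 f) + 𝓕 (hilbert f) +
      (α - β) • 𝓕 (hilbert (dx 2 f))) + 𝓕 (hilbert (mul (lambdaPow 1 f) (lambdaPow 1 f))) -
      (𝓕 (hilbert (mul f (lambdaPow 1 f))) - 𝓕 (mul f (hilbert (lambdaPow 1 f)))) +
      (α - β) • (𝓕 (hilbert (mul f (lambdaPow 3 f))) - 𝓕 (mul f (hilbert (lambdaPow 3 f)))) := by
    have hlin : ∀ g : L2C, 𝓕 g = Lp.fourierTransformₗᵢ ℝ ℂ g := fun _ => rfl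
    have hsm : ∀ (r : ℝ) (g : L2C), Lp.fourierTransformₗᵢ ℝ ℂ (r • g) =
        r • Lp.fourierTransformₗᵢ ℝ ℂ g := fun r g => by
      rw [real_smul_eq, real_smul_eq, (Lp.fourierTransformₗᵢ ℝ ℂ).map_smul]
    simp only [hlin, rhs, comm, map_add, map_sub, hsm]
  have hvel : d.vel Φ =ᵐ[volume] fun ξ => jbInv 3 ξ * (Complex.I * dispersion α β ε ξ) * Φ ξ +
      jbInv 3 ξ * kernelFun (quadKernel α β) Φ Φ ξ := by
    filter_upwards [Lp.coeFn_add (mulOp (fun ξ => jbInv 3 ξ * (Complex.I * d.p ξ)) Φ)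
      (mulOp (jbInv 3) (d.quad Φ)), coeFn_mulOp (d.isBddSymbol_jbInv_mul_p 2) Φ,
      coeFn_mulOp (isBddSymbol_jbInv 3) (d.quad Φ), coeFn_kernelOp d.isKernel Φ Φ]
      with ξ h1 h2 h3 h4
    rw [SemilinearData.vel, h1, Pi.add_apply, h2, h3, SemilinearData.quad, h4]
    rfl
  rw [hexp]
  filter_upwards [coeFn_rhs_combination ε⁻¹ (α - β) (𝓕 (dx 1 f)) (𝓕 (hilbert f))
    (𝓕 (hilbert (dx 2 f))) (𝓕 (hilbert (mul (lambdaPow 1 f) (lambdaPow 1 f))))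
    (𝓕 (hilbert (mul f (lambdaPow 1 f)))) (𝓕 (mul f (hilbert (lambdaPow 1 f))))
    (𝓕 (hilbert (mul f (lambdaPow 3 f)))) (𝓕 (mul f (hilbert (lambdaPow 3 f)))),
    hd1, hH hf, hH hd2, fourier_hilbert (mul (lambdaPow 1 f) (lambdaPow 1 f)),
    fourier_hilbert (mul f (lambdaPow 1 f)), fourier_hilbert (mul f (lambdaPow 3 f)),
    P1, P2, P3, P4, P5, hvel] with ξ c0 c1 c2 c3 c4 c5 c6 p1 p2 p3 p4 p5 cv
  rw [c0, c1, c2, c3, c4, c5, c6, p1.2, p2.2, p3.2, p4.2, p5.2, cv]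
  obtain ⟨i1, -⟩ := p1
  obtain ⟨i2, -⟩ := p2
  obtain ⟨i3, -⟩ := p3
  obtain ⟨i4, -⟩ := p4
  obtain ⟨i5, -⟩ := p5
  have hD : ((2 + α * |2 * Real.pi * ξ| : ℝ) : ℂ) ≠ 0 := by
    have : 0 < 2 + α * |2 * Real.pi * ξ| := by positivity
    exact_mod_cast this.ne'
  have hz : (jb ξ : ℂ) ≠ 0 := by exact_mod_cast (jb_pos ξ).ne'
  have hlinear : ((ε⁻¹ : ℝ) : ℂ) * ((Complex.I * ((2 * Real.pi * ξ : ℝ) : ℂ)) ^ 1 * jbInv 3 ξ * Φ ξ +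
      hilbertSymbol ξ * jbInv 3 ξ * Φ ξ + ((α - β : ℝ) : ℂ) * (hilbertSymbol ξ *
        ((Complex.I * ((2 * Real.pi * ξ : ℝ) : ℂ)) ^ 2 * jbInv 3 ξ) * Φ ξ)) =
      ((2 + α * |2 * Real.pi * ξ| : ℝ) : ℂ) *
        (jbInv 3 ξ * (Complex.I * dispersion α β ε ξ) * Φ ξ) := by
    have hdisp : ((2 + α * |2 * Real.pi * ξ| : ℝ) : ℂ) * (dispersion α β ε ξ : ℂ) =
        ((ε⁻¹ * (2 * Real.pi * ξ - Real.sign (2 * Real.pi * ξ) +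
          (α - β) * (Real.sign (2 * Real.pi * ξ) * (2 * Real.pi * ξ) ^ 2)) : ℝ) : ℂ) := by
      rw [dispersion, Complex.ofReal_div]
      field_simp
    calc _ = jbInv 3 ξ * Complex.I * Φ ξ * ((ε⁻¹ * (2 * Real.pi * ξ -
          Real.sign (2 * Real.pi * ξ) + (α - β) * (Real.sign (2 * Real.pi * ξ) *
            (2 * Real.pi * ξ) ^ 2)) : ℝ) : ℂ) := by
          rw [hilbertSymbol, mul_pow _ _ 2, Complex.I_sq]
          push_cast
          ring
      _ = _ := by
          rw [← hdisp]
          ring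
  have hquad : ((2 + α * |2 * Real.pi * ξ| : ℝ) : ℂ) *
      (jbInv 3 ξ * kernelFun (quadKernel α β) Φ Φ ξ) =
      ∫ η, (hilbertSymbol ξ * (jbInv 1 (ξ - η) * (((|2 * Real.pi * (ξ - η)| ^ 1 : ℝ) : ℂ) *
          jbInv 2 (ξ - η)) * (((|2 * Real.pi * η| ^ 1 : ℝ) : ℂ) * jbInv 3 η) *
          (Φ (ξ - η) * Φ η)) -
        (hilbertSymbol ξ * (jbInv 1 (ξ - η) * jbInv 2 (ξ - η) *
          (((|2 * Real.pi * η| ^ 1 : ℝ) : ℂ) * jbInv 3 η) * (Φ (ξ - η) * Φ η)) -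
        jbInv 1 (ξ - η) * jbInv 2 (ξ - η) * (hilbertSymbol η *
          (((|2 * Real.pi * η| ^ 1 : ℝ) : ℂ) * jbInv 3 η)) * (Φ (ξ - η) * Φ η)) +
        ((α - β : ℝ) : ℂ) * (hilbertSymbol ξ * (jbInv 1 (ξ - η) * jbInv 2 (ξ - η) *
          (((|2 * Real.pi * η| ^ 3 : ℝ) : ℂ) * jbInv 3 η) * (Φ (ξ - η) * Φ η)) -
        jbInv 1 (ξ - η) * jbInv 2 (ξ - η) * (hilbertSymbol η *
          (((|2 * Real.pi * η| ^ 3 : ℝ) : ℂ) * jbInv 3 η)) * (Φ (ξ - η) * Φ η))) := by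
    rw [kernelFun, ← integral_const_mul, ← integral_const_mul]
    refine integral_congr_ae (Eventually.of_forall fun η => ?_)
    -- The prefactor undoes `⟨ξ⟩³ / (2 + α|k|)` in the kernel, leaving the bare quadratic symbol and
    -- the weights of the two inputs.
    have hb : ((2 + α * |2 * Real.pi * ξ| : ℝ) : ℂ) * (jbInv 3 ξ * quadKernel α β ξ η) =
        -Complex.I * (quadSymbol (α - β) (2 * Real.pi * ξ) (2 * Real.pi * η) : ℂ) *
          (jbInv 3 (ξ - η) * jbInv 3 η) := by
      rw [quadKernel, jbInv, jbInv, jbInv, Complex.ofReal_mul, Complex.ofReal_mul,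
        Complex.ofReal_div]
      push_cast at hD ⊢
      field_simp
    simp only
    rw [← mul_assoc (jbInv 3 ξ), ← mul_assoc (((2 + α * |2 * Real.pi * ξ| : ℝ) : ℂ)), hb,
      quadSymbol, ← mul_sub (2 * Real.pi)]
    simp only [hilbertSymbol, jbInv]
    push_cast
    ring
  -- The combined integral may be split because, at almost every `ξ`, each of the five convolution
  -- integrands is integrable by itself.
  rw [hlinear, mul_add ((2 + α * |2 * Real.pi * ξ| : ℝ) : ℂ), hquad, integral_add, integral_sub, integral_sub, integral_const_mul,
    integral_const_mul, integral_const_mul, integral_sub, integral_const_mul]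
  · ring
  · exact i4.const_mul _
  · exact i5
  · exact i2.const_mul _
  · exact i3
  · exact i1.const_mul _
  · exact (i2.const_mul _).sub i3
  · exact (i1.const_mul _).sub ((i2.const_mul _).sub i3)
  · exact ((i4.const_mul _).sub i5).const_mul _

/-- The equation in Fourier variables. -/
theorem equation_iff {α : ℝ} (hα : 0 < α) (β : ℝ) {ε : ℝ} (hε : 0 < ε) {f h Φ : L2C}
    (hf : (𝓕 f : L2C) =ᵐ[volume] fun ξ => jbInv 3 ξ * Φ ξ)
    (hh : MemLp (fun ξ : ℝ => ((|2 * Real.pi * ξ| ^ 1 : ℝ) : ℂ) * (𝓕 h : L2C) ξ) 2 volume) :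
    (2 : ℝ) • h + α • lambdaPow 1 h = rhs α β ε f ↔ 𝓕 h = (waveData hα β hε).vel Φ := by
  have hΛ := fourier_multiplier_ae_eq (m := fun k => ((|k| ^ 1 : ℝ) : ℂ)) hh
  have hl : (𝓕 ((2 : ℝ) • h + α • lambdaPow 1 h) : L2C) =ᵐ[volume] fun ξ =>
      ((2 + α * |2 * Real.pi * ξ| : ℝ) : ℂ) * (𝓕 h : L2C) ξ := by
    have e : 𝓕 ((2 : ℝ) • h + α • lambdaPow 1 h) = (2 : ℝ) • 𝓕 h + α • 𝓕 (lambdaPow 1 h) := by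
      have hlin : ∀ g : L2C, 𝓕 g = Lp.fourierTransformₗᵢ ℝ ℂ g := fun _ => rfl
      simp only [hlin, map_add, real_smul_eq, map_smul]
    rw [e]
    filter_upwards [hΛ, Lp.coeFn_add ((2 : ℝ) • 𝓕 h) (α • 𝓕 (lambdaPow 1 h)),
      coeFn_real_smul 2 (𝓕 h), coeFn_real_smul α (𝓕 (lambdaPow 1 h))] with ξ h1 h2 h3 h4
    rw [h2, Pi.add_apply, h3, h4, lambdaPow, h1]
    push_cast
    ring
  have hr := fourier_rhs hα β hε hf
  constructor
  · intro heq
    apply Lp.ext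
    rw [heq] at hl
    filter_upwards [hl, hr] with ξ h1 h2
    have hD : ((2 + α * |2 * Real.pi * ξ| : ℝ) : ℂ) ≠ 0 := by
      have : 0 < 2 + α * |2 * Real.pi * ξ| := by positivity
      exact_mod_cast this.ne'
    rw [h1] at h2
    exact mul_left_cancel₀ hD h2
  · intro heq
    have : 𝓕 ((2 : ℝ) • h + α • lambdaPow 1 h) = 𝓕 (rhs α β ε f) := by
      apply Lp.ext
      filter_upwards [hl, hr] with ξ h1 h2
      rw [h1, h2, heq]
    exact (Lp.fourierTransformₗᵢ ℝ ℂ).injective this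

/-! ### Sobolev regularity in Fourier variables. -/

theorem toTemperedDistribution_injective :
    Function.Injective (fun f : L2C => (f : 𝓢'(ℝ, ℂ))) := by
  have h := Lp.ker_toTemperedDistributionCLM_eq_bot (F := ℂ) (μ := (volume : Measure ℝ)) (p := 2)
  exact LinearMap.ker_eq_bot.1 h

/-- The Bessel potential is normalised in `ξ` and not in `k = 2πξ`, which is why the weights use
`ξ`. -/
theorem rpow_eq_jbInv (n : ℕ) (ξ : ℝ) :
    (((1 + ‖ξ‖ ^ 2) ^ (-(n : ℝ) / 2) : ℝ) : ℂ) = jbInv n ξ := by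
  rw [jbInv, ← Complex.ofReal_inv, ← Complex.ofReal_pow, jb, Real.norm_eq_abs, sq_abs,
    Real.sqrt_eq_rpow, ← Real.rpow_neg (by positivity),
    ← Real.rpow_mul_natCast (by positivity)]
  congr 2
  ring

/-- The Bessel potential operator in Fourier variables. -/
theorem besselPotential_eq_iff (n : ℕ) (f g : L2C) :
    TemperedDistribution.besselPotential ℝ ℂ n (f : 𝓢'(ℝ, ℂ)) = (g : 𝓢'(ℝ, ℂ)) ↔
      𝓕 f = mulOp (jbInv n) (𝓕 g) := by
  rw [← TemperedDistribution.besselPotential_neg_apply_eq_iff]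
  have hb := (isBddSymbol_jbInv n).memLp
  have hfun : (fun x : ℝ => (((1 + ‖x‖ ^ 2) ^ (-(n : ℝ) / 2) : ℝ) : ℂ)) = jbInv n :=
    funext (rpow_eq_jbInv n)
  have htg : (jbInv n).HasTemperateGrowth := by
    rw [← hfun]
    fun_prop
  have e : 𝓕 (TemperedDistribution.besselPotential ℝ ℂ (-(n : ℝ)) (g : 𝓢'(ℝ, ℂ))) =
      ((mulOp (jbInv n) (𝓕 g) : L2C) : 𝓢'(ℝ, ℂ)) := by
    rw [TemperedDistribution.fourier_besselPotential_eq_smulLeftCLM_fourier_apply, hfun,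
      Lp.fourier_toTemperedDistribution_eq, ← Lp.toTemperedDistribution_smul_eq (r := 2) htg hb]
    congr 1
    apply Lp.ext
    filter_upwards [Lp.coeFn_lpSMul (r := 2) hb.toLp (𝓕 g), hb.coeFn_toLp,
      coeFn_mulOp (isBddSymbol_jbInv n) (𝓕 g)] with ξ h1 h2 h3
    rw [h1, h3, Pi.smul_apply', h2, smul_eq_mul]
  constructor
  · intro h
    rw [h, Lp.fourier_toTemperedDistribution_eq] at e
    exact toTemperedDistribution_injective e
  · intro h
    rw [← h, ← Lp.fourier_toTemperedDistribution_eq] at e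
    have := congrArg (fun u : 𝓢'(ℝ, ℂ) => 𝓕⁻ u) e
    simpa only [FourierTransform.fourierInv_fourier_eq] using this

/-! ### Conjugation symmetry and real-valuedness. -/

/-- The involution `Φ ↦ conj Φ(-ξ)`, which corresponds to complex conjugation under the Fourier
transform. -/
def reflConj : L2C →L[ℝ] L2C :=
  ((Complex.conjCLE : ℂ →L[ℝ] ℂ).compLpL 2 (volume : Measure ℝ)).comp
    (Lp.compMeasurePreservingₗᵢ ℝ (Neg.neg : ℝ → ℝ)
      (Measure.measurePreserving_neg volume)).toContinuousLinearMap

theorem ae_neg {p : ℝ → Prop} (h : ∀ᵐ x, p x) : ∀ᵐ x, p (-x) :=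
  (Measure.measurePreserving_neg (volume : Measure ℝ)).quasiMeasurePreserving.ae h

theorem coeFn_reflConj (Φ : L2C) :
    reflConj Φ =ᵐ[volume] fun ξ => (starRingEnd ℂ) (Φ (-ξ)) := by
  have h1 := ContinuousLinearMap.coeFn_compLpL (Complex.conjCLE : ℂ →L[ℝ] ℂ)
    (Lp.compMeasurePreserving (Neg.neg : ℝ → ℝ) (Measure.measurePreserving_neg volume) Φ)
  filter_upwards [h1, Lp.coeFn_compMeasurePreserving Φ
    (Measure.measurePreserving_neg (volume : Measure ℝ))] with ξ h2 h3
  refine h2.trans ?_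
  rw [h3]
  rfl

/-- Complex conjugation on `L²`. -/
def conjL : L2C →L[ℝ] L2C := (Complex.conjCLE : ℂ →L[ℝ] ℂ).compLpL 2 (volume : Measure ℝ)

theorem coeFn_conjL (f : L2C) : conjL f =ᵐ[volume] fun x => (starRingEnd ℂ) (f x) :=
  ContinuousLinearMap.coeFn_compLpL (Complex.conjCLE : ℂ →L[ℝ] ℂ) f

theorem fourierInv_conj_neg (h : ℝ → ℂ) (x : ℝ) :
    (𝓕⁻ fun ξ => (starRingEnd ℂ) (h (-ξ))) x = (starRingEnd ℂ) ((𝓕⁻ h) x) := by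
  rw [Real.fourierInv_eq', Real.fourierInv_eq', ← integral_conj, ← integral_neg_eq_self]
  congr 1
  ext ξ
  simp only [smul_eq_mul, map_mul, neg_neg, ← Complex.exp_conj, inner_neg_left]
  congr 2
  simp [Complex.conj_ofNat]

theorem fourierInv_reflConj (Φ : L2C) : 𝓕⁻ (reflConj Φ) = conjL (𝓕⁻ Φ) := by
  refine DenseRange.induction_on (p := fun Φ : L2C => 𝓕⁻ (reflConj Φ) = conjL (𝓕⁻ Φ))
    (SchwartzMap.denseRange_toLpCLM (p := 2) ENNReal.ofNat_ne_top) Φ ?_ ?_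
  · apply isClosed_eq
    · exact (fourierInvCLM ℂ L2C).continuous.comp reflConj.continuous
    · exact conjL.continuous.comp (fourierInvCLM ℂ L2C).continuous
  · intro φ
    simp only [SchwartzMap.toLpCLM_apply]
    set Ψ : L2C := φ.toLp 2 volume with hΨ
    set h : ℝ → ℂ := fun ξ => (starRingEnd ℂ) (φ (-ξ)) with hh
    have h1 : Integrable h := by
      have := φ.integrable.comp_neg (μ := (volume : Measure ℝ))
      exact (Complex.conjCLE : ℂ →L[ℝ] ℂ).integrable_comp this
    have e1 : reflConj Ψ =ᵐ[volume] h := by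
      filter_upwards [coeFn_reflConj Ψ, ae_neg (φ.coeFn_toLp 2 volume)] with ξ h2 h3
      rw [h2, hΨ, h3]
    have h2 : MemLp h 2 volume := (memLp_congr_ae e1).1 (Lp.memLp _)
    have e2 : reflConj Ψ = h2.toLp := Lp.ext (e1.trans h2.coeFn_toLp.symm)
    have e3 : (𝓕⁻ Ψ : L2C) =ᵐ[volume] (𝓕⁻ (φ : ℝ → ℂ) : ℝ → ℂ) := by
      rw [hΨ, SchwartzMap.toLp_fourierInv_eq]
      filter_upwards [(𝓕⁻ φ).coeFn_toLp 2 volume] with x hx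
      rw [hx, SchwartzMap.fourierInv_coe]
    apply Lp.ext
    rw [e2]
    filter_upwards [fourierInv_toLp_ae_eq h1 h2, coeFn_conjL (𝓕⁻ Ψ), e3] with x h3 h4 h5
    rw [h3, h4, h5, hh, fourierInv_conj_neg]

theorem reflConj_mulOp {m : ℝ → ℂ} (hm : IsBddSymbol m)
    (hs : ∀ ξ, (starRingEnd ℂ) (m (-ξ)) = m ξ) (Φ : L2C) :
    reflConj (mulOp m Φ) = mulOp m (reflConj Φ) := by
  apply Lp.ext
  filter_upwards [coeFn_reflConj (mulOp m Φ), ae_neg (coeFn_mulOp hm Φ),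
    coeFn_mulOp hm (reflConj Φ), coeFn_reflConj Φ] with ξ h1 h2 h3 h4
  rw [h1, h2, h3, h4, map_mul, hs]

theorem reflConj_kernelOp {b : ℝ → ℝ → ℂ} {M : ℝ} (hb : IsKernel b M)
    (hs : ∀ ξ η, (starRingEnd ℂ) (b (-ξ) (-η)) = b ξ η) (Φ Ψ : L2C) :
    reflConj (kernelOp hb Φ Ψ) = kernelOp hb (reflConj Φ) (reflConj Ψ) := by
  apply Lp.ext
  filter_upwards [coeFn_reflConj (kernelOp hb Φ Ψ), ae_neg (coeFn_kernelOp hb Φ Ψ),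
    coeFn_kernelOp hb (reflConj Φ) (reflConj Ψ)] with ξ h1 h2 h3
  rw [h1, h2, h3, kernelFun_congr (coeFn_reflConj Φ) (coeFn_reflConj Ψ), kernelFun, kernelFun,
    ← integral_conj, ← integral_neg_eq_self]
  congr 1
  ext η
  rw [map_mul, hs, map_mul]
  congr 4
  ring

namespace SemilinearData

variable (d : SemilinearData)

/-- The symbols are those of an equation with real coefficients. -/
def IsReal : Prop :=
  (∀ ξ, d.p (-ξ) = -d.p ξ) ∧ ∀ ξ η, (starRingEnd ℂ) (d.b (-ξ) (-η)) = d.b ξ η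

variable {d}

theorem IsReal.reflConj_grp (hd : d.IsReal) (t : ℝ) (Φ : L2C) :
    reflConj (d.grp t Φ) = d.grp t (reflConj Φ) := by
  refine reflConj_mulOp (isBddSymbol_exp isBddSymbol_one d.measurable_p t) (fun ξ => ?_) Φ
  rw [one_mul, one_mul, ← Complex.exp_conj, map_mul, Complex.conj_I, Complex.conj_ofReal, hd.1]
  congr 1
  push_cast
  ring

theorem IsReal.reflConj_quad (hd : d.IsReal) (Φ : L2C) :
    reflConj (d.quad Φ) = d.quad (reflConj Φ) :=
  reflConj_kernelOp d.isKernel hd.2 Φ Φ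

theorem IsReal.reflConj_field (hd : d.IsReal) (t : ℝ) (Φ : L2C) :
    reflConj (d.field t Φ) = d.field t (reflConj Φ) := by
  rw [field, hd.reflConj_grp, hd.reflConj_quad, hd.reflConj_grp, field]

theorem conj_jbInv_neg (n : ℕ) (ξ : ℝ) : (starRingEnd ℂ) (jbInv n (-ξ)) = jbInv n ξ := by
  rw [jbInv, jb_neg, map_pow, map_inv₀, Complex.conj_ofReal, jbInv]

theorem IsReal.reflConj_vel (hd : d.IsReal) (Φ : L2C) :
    reflConj (d.vel Φ) = d.vel (reflConj Φ) := by
  rw [vel, map_add, reflConj_mulOp (d.isBddSymbol_jbInv_mul_p 2),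
    reflConj_mulOp (isBddSymbol_jbInv 3) (conj_jbInv_neg 3), hd.reflConj_quad, vel]
  intro ξ
  rw [map_mul, conj_jbInv_neg, map_mul, Complex.conj_I, Complex.conj_ofReal, hd.1]
  push_cast
  ring

/-- Solutions with real initial data are real. -/
theorem IsReal.reflConj_eq (hd : d.IsReal) {T : ℝ} {U : ℝ → L2C}
    (hU : ∀ t ∈ Set.Icc 0 T, HasDerivWithinAt U (d.field t (U t)) (Set.Icc 0 T) t)
    (h0 : reflConj (U 0) = U 0) {t : ℝ} (ht : t ∈ Set.Icc 0 T) : reflConj (U t) = U t := by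
  -- The reflected curve solves the same equation with the same datum, so uniqueness identifies the
  -- two.
  refine d.isLocLipField.eqOn (U := fun t => reflConj (U t)) (V := U) (fun t ht => ?_) hU h0 ht
  rw [← hd.reflConj_field]
  exact reflConj.hasFDerivAt.comp_hasDerivWithinAt t (hU t ht)

end SemilinearData

theorem isReal_waveData {α : ℝ} (hα : 0 < α) (β : ℝ) {ε : ℝ} (hε : 0 < ε) :
    (waveData hα β hε).IsReal := by
  constructor
  · intro ξ
    change dispersion α β ε (-ξ) = -dispersion α β ε ξ
    rw [dispersion, dispersion, mul_neg, Real.sign_neg, abs_neg]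
    ring
  · intro ξ η
    change (starRingEnd ℂ) (quadKernel α β (-ξ) (-η)) = quadKernel α β ξ η
    have h1 : -ξ - -η = -(ξ - η) := by ring
    have h2 : -(2 * Real.pi * ξ) - -(2 * Real.pi * η) =
      -(2 * Real.pi * ξ - 2 * Real.pi * η) := by ring
    rw [quadKernel, quadKernel, map_mul, map_neg, Complex.conj_I, Complex.conj_ofReal, quadSymbol,
      quadSymbol, h1, mul_neg, mul_neg, h2, jb_neg, jb_neg, jb_neg, abs_neg, abs_neg, abs_neg,
      Real.sign_neg, Real.sign_neg]
    push_cast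
    ring

/-! ### Real-valued functions and their transforms. -/

/-- The inclusion of real-valued into complex-valued functions as a bounded operator. -/
def toCL : L2R →L[ℝ] L2C := Complex.ofRealCLM.compLpL 2 (volume : Measure ℝ)

/-- The pointwise real part. -/
def reL : L2C →L[ℝ] L2R := Complex.reCLM.compLpL 2 (volume : Measure ℝ)

theorem coeFn_toC (f : L2R) : toC f =ᵐ[volume] fun x => (f x : ℂ) :=
  ContinuousLinearMap.coeFn_compLpL Complex.ofRealCLM f

theorem coeFn_reL (f : L2C) : reL f =ᵐ[volume] fun x => (f x).re :=
  ContinuousLinearMap.coeFn_compLpL Complex.reCLM f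

theorem reL_toC (f : L2R) : reL (toC f) = f := by
  apply Lp.ext
  filter_upwards [coeFn_reL (toC f), coeFn_toC f] with x h1 h2
  rw [h1, h2, Complex.ofReal_re]

theorem toC_reL {f : L2C} (hf : conjL f = f) : toC (reL f) = f := by
  apply Lp.ext
  have h := coeFn_conjL f
  rw [hf] at h
  filter_upwards [coeFn_toC (reL f), coeFn_reL f, h] with x h1 h2 h3
  rw [h1, h2]
  exact Complex.conj_eq_iff_re.1 h3.symm

theorem conjL_toC (f : L2R) : conjL (toC f) = toC f := by
  apply Lp.ext
  filter_upwards [coeFn_conjL (toC f), coeFn_toC f] with x h1 h2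
  rw [h1, h2, Complex.conj_ofReal]

/-- The Fourier transform of real-valued functions. -/
def fourierR : L2R →L[ℝ] L2C :=
  ((Lp.fourierTransformₗᵢ ℝ ℂ).toContinuousLinearEquiv.toContinuousLinearMap.restrictScalars
    ℝ).comp toCL

/-- The real part of the inverse Fourier transform. -/
def reFourierInv : L2C →L[ℝ] L2R :=
  reL.comp ((Lp.fourierTransformₗᵢ ℝ ℂ).symm.toContinuousLinearEquiv.toContinuousLinearMap.restrictScalars
    ℝ)

theorem fourierR_apply (f : L2R) : fourierR f = 𝓕 (toC f) := rfl

theorem reFourierInv_apply (Φ : L2C) : reFourierInv Φ = reL (𝓕⁻ Φ) := rfl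

theorem reFourierInv_fourierR (f : L2R) : reFourierInv (fourierR f) = f := by
  rw [reFourierInv_apply, fourierR_apply, FourierTransform.fourierInv_fourier_eq, reL_toC]

theorem fourierR_injective : Function.Injective fourierR :=
  Function.LeftInverse.injective reFourierInv_fourierR

theorem reflConj_fourierR (f : L2R) : reflConj (fourierR f) = fourierR f := by
  have h := fourierInv_reflConj (fourierR f)
  rw [fourierR_apply, FourierTransform.fourierInv_fourier_eq, conjL_toC] at h
  have h2 := congrArg (fun x : L2C => (𝓕 x : L2C)) h
  have h3 : reflConj (𝓕 (toC f)) = 𝓕 (toC f) := by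
    simpa only [FourierTransform.fourier_fourierInv_eq] using h2
  exact h3

theorem toC_reFourierInv {Φ : L2C} (h : reflConj Φ = Φ) : toC (reFourierInv Φ) = 𝓕⁻ Φ :=
  have e : conjL (𝓕⁻ Φ) = 𝓕⁻ Φ := by rw [← fourierInv_reflConj, h]
  toC_reL e

theorem fourierR_reFourierInv {Φ : L2C} (h : reflConj Φ = Φ) : fourierR (reFourierInv Φ) = Φ := by
  rw [fourierR_apply, toC_reFourierInv h, FourierTransform.fourier_fourierInv_eq]

/-- Membership in `Hⁿ` in Fourier variables. -/
theorem memH_iff (n : ℕ) (f : L2R) :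
    MemH n f ↔ ∃ Φ : L2C, fourierR f = mulOp (jbInv n) Φ := by
  constructor
  · rintro ⟨g, hg⟩
    exact ⟨𝓕 g, (besselPotential_eq_iff n (toC f) g).1 hg⟩
  · rintro ⟨Φ, hΦ⟩
    refine ⟨𝓕⁻ Φ, (besselPotential_eq_iff n (toC f) (𝓕⁻ Φ)).2 ?_⟩
    rw [FourierTransform.fourier_fourierInv_eq]
    exact hΦ

theorem memLp_abs_mul_of_eq_mulOp {h Ψ : L2C} (hh : 𝓕 h = mulOp (jbInv 1) Ψ) :
    MemLp (fun ξ : ℝ => ((|2 * Real.pi * ξ| ^ 1 : ℝ) : ℂ) * (𝓕 h : L2C) ξ) 2 volume := by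
  have hb := isBddSymbol_lambda (j := 1) (n := 1) le_rfl
  refine (memLp_congr_ae ?_).1 (Lp.memLp (mulOp (fun ξ =>
    ((|2 * Real.pi * ξ| ^ 1 : ℝ) : ℂ) * jbInv 1 ξ) Ψ))
  rw [hh]
  filter_upwards [coeFn_mulOp hb Ψ, coeFn_mulOp (isBddSymbol_jbInv 1) Ψ] with ξ h1 h2
  rw [h1, h2, mul_assoc]

/-- Pulling out one weight shows that the time derivative is automatically in `H¹`; the two weights
left inside still dominate the order-one symbol `p`. -/
theorem SemilinearData.vel_eq_mulOp (d : SemilinearData) (Φ : L2C) :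
    d.vel Φ = mulOp (jbInv 1)
      (mulOp (fun ξ => jbInv 2 ξ * (Complex.I * d.p ξ)) Φ + mulOp (jbInv 2) (d.quad Φ)) := by
  rw [map_add, mulOp_mulOp (isBddSymbol_jbInv 1) (d.isBddSymbol_jbInv_mul_p 1),
    mulOp_mulOp (isBddSymbol_jbInv 1) (isBddSymbol_jbInv 2), vel]
  congr 3
  · funext ξ
    simp only [jbInv]
    ring
  · funext ξ
    simp only [jbInv]
    ring

/-- The equation for real-valued functions in Fourier variables. -/
theorem equation_iff_fourierR {α : ℝ} (hα : 0 < α) (β : ℝ) {ε : ℝ} (hε : 0 < ε) {f h : L2R}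
    {Φ : L2C} (hf : fourierR f = mulOp (jbInv 3) Φ) :
    (MemH 1 h ∧ (2 : ℝ) • toC h + α • lambdaPow 1 (toC h) = rhs α β ε (toC f)) ↔
      fourierR h = (waveData hα β hε).vel Φ := by
  have hf' : (𝓕 (toC f) : L2C) =ᵐ[volume] fun ξ => jbInv 3 ξ * Φ ξ := by
    rw [← fourierR_apply, hf]
    exact coeFn_mulOp (isBddSymbol_jbInv 3) Φ
  have hM := memH_iff 1 h
  rw [Nat.cast_one] at hM
  rw [hM]
  constructor
  · rintro ⟨⟨Ψ, hΨ⟩, he⟩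
    exact (equation_iff hα β hε hf' (memLp_abs_mul_of_eq_mulOp hΨ)).1 he
  · intro he
    have hΨ := he.trans ((waveData hα β hε).vel_eq_mulOp Φ)
    exact ⟨⟨_, hΨ⟩, (equation_iff hα β hε hf' (memLp_abs_mul_of_eq_mulOp hΨ)).2 he⟩

/-! ### Passage between solutions and the interaction picture. -/

theorem memLp_top_of_continuousOn {X : Type*} [NormedAddCommGroup X] {u : ℝ → X} {T : ℝ}
    (hu : ContinuousOn u (Set.Icc 0 T)) : MemLp u ∞ (timeMeasure T) := by
  obtain ⟨C, hC⟩ := isCompact_Icc.exists_bound_of_continuousOn hu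
  refine memLp_top_of_bound
    ((hu.mono Set.Ioo_subset_Icc_self).aestronglyMeasurable measurableSet_Ioo) C ?_
  filter_upwards [ae_restrict_mem measurableSet_Ioo] with t ht
  exact hC t (Set.Ioo_subset_Icc_self ht)

theorem integrable_of_continuousOn {X : Type*} [NormedAddCommGroup X] {u : ℝ → X} {T : ℝ}
    (hu : ContinuousOn u (Set.Icc 0 T)) : Integrable u (timeMeasure T) :=
  (hu.integrableOn_Icc).mono_set Set.Ioo_subset_Icc_self

/-- A continuous real-valued solution in Fourier variables yields a solution. -/
theorem isSolution_of_fourierR {α : ℝ} (hα : 0 < α) (β : ℝ) {ε : ℝ} (hε : 0 < ε) {T : ℝ}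
    {f₀ : L2R} {f : ℝ → L2R} {G : ℝ → L2C}
    (hf : ∀ t ∈ Set.Icc 0 T, fourierR (f t) = mulOp (jbInv 3) (G t))
    (hGc : ContinuousOn G (Set.Icc 0 T)) (hreal : ∀ t ∈ Set.Icc 0 T, reflConj (G t) = G t)
    (hint : ∀ t ∈ Set.Icc 0 T, mulOp (jbInv 3) (G t) =
      fourierR f₀ + ∫ s in (0 : ℝ)..t, (waveData hα β hε).vel (G s)) :
    IsSolution α β ε T f₀ f := by
  have hvc : ContinuousOn (fun t => (waveData hα β hε).vel (G t)) (Set.Icc 0 T) :=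
    (waveData hα β hε).continuous_vel.comp_continuousOn hGc
  have hIoo : ∀ᵐ t ∂timeMeasure T, t ∈ Set.Icc 0 T := by
    filter_upwards [ae_restrict_mem measurableSet_Ioo] with t ht
    exact Set.Ioo_subset_Icc_self ht
  have hH : MemLinftyH 3 T f := by
    refine ⟨fun t => 𝓕⁻ (G t),
      memLp_top_of_continuousOn ((fourierInvCLM ℂ L2C).continuous.comp_continuousOn hGc), ?_⟩
    filter_upwards [hIoo] with t ht
    refine (besselPotential_eq_iff 3 _ _).2 ?_
    rw [FourierTransform.fourier_fourierInv_eq]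
    exact hf t ht
  have hinteg : ∀ᵐ t ∂timeMeasure T,
      f t = f₀ + ∫ s in (0 : ℝ)..t, reFourierInv ((waveData hα β hε).vel (G s)) := by
    filter_upwards [hIoo] with t ht
    rw [← reFourierInv_fourierR (f t), hf t ht, hint t ht, map_add, reFourierInv_fourierR,
      ← ContinuousLinearMap.intervalIntegral_comp_comm]
    apply ContinuousOn.intervalIntegrable
    rw [Set.uIcc_of_le ht.1]
    exact hvc.mono (Set.Icc_subset_Icc_right ht.2)
  -- Taking the real part loses nothing in this choice of `f_t`: the velocity inherits the
  -- conjugation symmetry of `G`.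
  refine ⟨hH, fun t => reFourierInv ((waveData hα β hε).vel (G t)),
    integrable_of_continuousOn (reFourierInv.continuous.comp_continuousOn hvc), hinteg, ?_⟩
  filter_upwards [hIoo] with t ht
  refine (equation_iff_fourierR hα β hε (hf t ht)).2 (fourierR_reFourierInv ?_)
  rw [(isReal_waveData hα β hε).reflConj_vel, hreal t ht]

/-- The solution in the interaction picture with real initial data is a real solution. -/
theorem SemilinearData.IsReal.reflConj_grp_eq {d : SemilinearData} (hd : d.IsReal) {T : ℝ}
    {U : ℝ → L2C} (hreal : reflConj (U 0) = U 0)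
    (hU : ∀ t ∈ Set.Icc 0 T, HasDerivWithinAt U (d.field t (U t)) (Set.Icc 0 T) t) {t : ℝ}
    (ht : t ∈ Set.Icc 0 T) : reflConj (d.grp t (U t)) = d.grp t (U t) := by
  rw [hd.reflConj_grp, hd.reflConj_eq hU hreal ht]

/-- Every solution comes from the solution in the interaction picture. -/
theorem IsSolution.ae_fourierR_eq {α : ℝ} (hα : 0 < α) (β : ℝ) {ε : ℝ} (hε : 0 < ε) {T T' : ℝ}
    (hT' : T' ≤ T) {f₀ : L2R} {U : ℝ → L2C} (h0 : fourierR f₀ = mulOp (jbInv 3) (U 0))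
    (hU : ∀ t ∈ Set.Icc 0 T,
      HasDerivWithinAt U ((waveData hα β hε).field t (U t)) (Set.Icc 0 T) t)
    {g : ℝ → L2R} (hg : IsSolution α β ε T' f₀ g) :
    ∀ᵐ t ∂timeMeasure T',
      fourierR (g t) = mulOp (jbInv 3) ((waveData hα β hε).grp t (U t)) := by
  set d := waveData hα β hε with hd_def
  obtain ⟨⟨G, hGm, hGb⟩, a, ha, hga, heq⟩ := hg
  have hGF : ∀ᵐ t ∂timeMeasure T', fourierR (g t) = mulOp (jbInv 3) (𝓕 (G t)) := by
    filter_upwards [hGb] with t ht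
    exact (besselPotential_eq_iff 3 (toC (g t)) (G t)).1 ht
  have hG' : MemLp (fun t => 𝓕 (G t)) ∞ (timeMeasure T') :=
    hGm.of_le ((fourierCLM ℂ L2C).continuous.comp_aestronglyMeasurable hGm.1)
      (Eventually.of_forall fun t => (Lp.norm_fourier_eq (G t)).le)
  have ha' : Integrable (fun s => fourierR (a s)) (timeMeasure T') := fourierR.integrable_comp ha
  have hav : ∀ᵐ s ∂timeMeasure T', fourierR (a s) = d.vel (𝓕 (G s)) := by
    filter_upwards [hGF, heq] with s h1 h2
    exact (equation_iff_fourierR hα β hε h1).1 h2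
  have hint : ∀ᵐ t ∂timeMeasure T', mulOp (jbInv 3) (𝓕 (G t)) =
      mulOp (jbInv 3) (U 0) + ∫ s in (0 : ℝ)..t, fourierR (a s) := by
    filter_upwards [hGF, hga, ae_restrict_mem measurableSet_Ioo] with t h1 h2 ht
    rw [← h1, h2, map_add, h0, ← ContinuousLinearMap.intervalIntegral_comp_comm]
    exact (intervalIntegrable_iff_integrableOn_Ioo_of_le ht.1.le).2
      (ha.mono_measure (Measure.restrict_mono (Set.Ioo_subset_Ioo_right ht.2.le) le_rfl))
  obtain ⟨hFi, hF⟩ := d.grp_neg_eq_integral hG' ha' hav hint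
  filter_upwards [d.isLocLipField.ae_eq hT' hU hFi hF, hGF] with t h1 h2
  rw [h2, ← h1, d.grp_grp_neg]

attribute [local irreducible] waveData

/-- The initial value problem with datum `f₀` from a solution in the interaction picture. -/
theorem exists_unique_of_hasDerivWithinAt {α : ℝ} (hα : 0 < α) (β : ℝ) {ε : ℝ} (hε : 0 < ε)
    {T : ℝ} {f₀ : L2R} {U : ℝ → L2C} (h0 : fourierR f₀ = mulOp (jbInv 3) (U 0))
    (hU : ∀ t ∈ Set.Icc 0 T,
      HasDerivWithinAt U ((waveData hα β hε).field t (U t)) (Set.Icc 0 T) t) :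
    ∃ f : ℝ → L2R, IsSolution α β ε T f₀ f ∧
      ∀ (T' : ℝ) (g : ℝ → L2R), T' ≤ T → IsSolution α β ε T' f₀ g →
        ∀ᵐ t ∂timeMeasure T', g t = f t := by
  have hb := isBddSymbol_jbInv 3
  have hbc := SemilinearData.conj_jbInv_neg 3
  -- The weight is even, real and nowhere zero, so the symmetry of the transform of the real datum
  -- passes to `U 0`.
  have hreal : reflConj (U 0) = U 0 := by
    apply mulOp_injective hb (jbInv_ne_zero 3)
    rw [← reflConj_mulOp hb hbc, ← h0, reflConj_fourierR]
  have hUc : ContinuousOn U (Set.Icc 0 T) := fun s hs => (hU s hs).continuousWithinAt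
  obtain ⟨G, hG⟩ : ∃ G : ℝ → L2C, ∀ t, G t = (waveData hα β hε).grp t (U t) := ⟨_, fun _ => rfl⟩
  have hGc : ContinuousOn G (Set.Icc 0 T) :=
    ((waveData hα β hε).continuous_grp.comp_continuousOn (continuousOn_id.prodMk hUc)).congr
      fun t _ => hG t
  have hGr : ∀ t ∈ Set.Icc 0 T, reflConj (G t) = G t := fun t ht => by
    rw [hG t]
    exact (isReal_waveData hα β hε).reflConj_grp_eq hreal hU ht
  have hf : ∀ t ∈ Set.Icc 0 T,
      fourierR (reFourierInv (mulOp (jbInv 3) (G t))) = mulOp (jbInv 3) (G t) := fun t ht => by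
    apply fourierR_reFourierInv
    rw [reflConj_mulOp hb hbc, hGr t ht]
  refine ⟨fun t => reFourierInv (mulOp (jbInv 3) (G t)),
    isSolution_of_fourierR hα β hε hf hGc hGr fun t ht => ?_, fun T' g hT' hg => ?_⟩
  · rw [h0]
    simp only [hG]
    exact (waveData hα β hε).jbInv_grp_eq_integral hU ht
  · filter_upwards [hg.ae_fourierR_eq hα β hε hT' h0 hU, ae_restrict_mem measurableSet_Ioo]
      with t h1 ht
    apply fourierR_injective
    rw [h1, hf t ⟨ht.1.le, ht.2.le.trans hT'⟩, hG t]

end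

end OddWaves

theorem theorem3 (α β ε : ℝ) (hα : 0 < α) (hβ : 0 ≤ β) (hε : 0 < ε)
    (f₀ : OddWaves.L2R) (hf₀ : OddWaves.MemH 3 f₀) :
    ∃ T : ℝ, 0 < T ∧ ∃ f : ℝ → OddWaves.L2R,
      OddWaves.IsSolution α β ε T f₀ f ∧
      ∀ (T' : ℝ) (g : ℝ → OddWaves.L2R), 0 < T' → T' ≤ T →
        OddWaves.IsSolution α β ε T' f₀ g →
        ∀ᵐ t ∂OddWaves.timeMeasure T', g t = f t := by
  -- The weighted transform of `f₀` is also the datum in the interaction picture, since the group is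
  -- the identity at time `0`.
  obtain ⟨U₀, h0⟩ := (OddWaves.memH_iff 3 f₀).1 hf₀
  obtain ⟨T, hT, U, hU0, hU⟩ := (OddWaves.waveData hα β hε).isLocLipField.exists_solution U₀
  rw [← hU0] at h0
  obtain ⟨f, hf, hun⟩ := OddWaves.exists_unique_of_hasDerivWithinAt hα β hε h0 hU
  exact ⟨T, hT, f, hf, fun T' g _ => hun T' g⟩
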